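/- Let $\mathbb F$ be an arbitrary field. For integers $n\ge 0$, $d\ge 2$ and $p\in[0,1]$, let $X_d(n,p)$ denote the random simplicial complex on $n$ vertices that has a full $(d-1)$-dimensional skeleton and in which each of the $\binom{n}{d+1}$ possible $d$-dimensional faces is included independently with probability $p$; it has no faces of dimension greater than $d$. Write $H_d(X;\mathbb F)$ for the $d$-th simplicial homology of $X$ with coefficients in $\mathbb F$. For every $d\ge 2$ the equation $$-\ln(1-\beta)=\frac{(d+1)\,\beta}{d+1-d\beta}$$ has exactly one root $\beta=\beta_d$ in $(0,1)$. Put $$c^*_d=\frac{-\ln(1-\beta_d)}{\beta_d^{\,d}} .$$ 1. Let $d\ge 2$ and $c>c^*_d$ be fixed. Then $X\sim X_d(n,\tfrac cn)$ satisfies $H_d(X;\mathbb F)\ne 0$ asymptotically almost surely, that is, $\Pr[H_d(X;\mathbb F)\neq 0]\to 1$ as $n\to\infty$. 2. Rounded to the digits shown, $c^*_2=2.75381$, $c^*_3=3.90708$, $\beta_2=0.883414$ and $\beta_3=0.972498$. 3. As $d\to\infty$, $$c^*_d=(d+1)-\frac{d+1}{e^{\,d+1}}+O\!\left(\frac{d^3}{e^{2d}}\right)\qquad\text{and}\qquad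 \beta_d=1-e^{-(d+1)}-(1+o_d(1))\,\frac{(d+1)^2}{e^{2(d+1)}} .$$ -/

import Mathlib

open Filter Topology Asymptotics MeasureTheory ProbabilityTheory

noncomputable section

namespace RandomComplex

/-! ### Simplicial homology with coefficients in a field -/

/-- The quotient `Z / (Z ∩ B)` of two subspaces of a common space; it is `Z / B` if `B ≤ Z`. -/
abbrev Subquotient {R M : Type*} [Ring R] [AddCommGroup M] [Module R M] (Z B : Submodule R M) :
    Type _ :=
  Z ⧸ B.submoduleOf Z

section Homology

variable (F : Type*) [Field F] {V : Type*} [LinearOrder V]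

/-- The oriented boundary of a simplex whose vertices are listed in increasing order:
`∂ [v₀ < ⋯ < vₖ] = ∑ i, (-1) ^ i • [v₀, …, v̂ᵢ, …, vₖ]`; it is zero on vertices. The exponent is
the position of the removed vertex. -/
def simplexBoundary (s : Finset V) : Finset V →₀ F :=
  if s.card ≤ 1 then 0
  else ∑ v ∈ s, Finsupp.single (s.erase v) ((-1) ^ (s.filter (· < v)).card)

/-- The boundary operator: the linear extension of `simplexBoundary`. -/
def boundary : (Finset V →₀ F) →ₗ[F] (Finset V →₀ F) :=
  Finsupp.linearCombination F (simplexBoundary F)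

/-- The space of `k`-chains of `X`, spanned by the faces of dimension `k`, that is, those with
`k + 1` vertices. -/
def chains (X : PreAbstractSimplicialComplex V) (k : ℕ) : Submodule F (Finset V →₀ F) :=
  Finsupp.supported F F {s | s ∈ X ∧ s.card = k + 1}

/-- The `k`-cycles of `X`. -/
def cycles (X : PreAbstractSimplicialComplex V) (k : ℕ) : Submodule F (Finset V →₀ F) :=
  chains F X k ⊓ LinearMap.ker (boundary F)

/-- The `k`-boundaries of `X`: the boundaries of its `(k+1)`-chains. -/
def boundaries (X : PreAbstractSimplicialComplex V) (k : ℕ) : Submodule F (Finset V →₀ F) :=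
  (chains F X (k + 1)).map (boundary F)

/-- The simplicial homology group `H_k(X; F)`, cycles modulo boundaries. -/
abbrev Homology (X : PreAbstractSimplicialComplex V) (k : ℕ) : Type _ :=
  Subquotient (cycles F X k) (boundaries F X k)

end Homology

/-! ### The random complex `X_d(n, p)` -/

/-- The complex on the vertex set `{0, …, n - 1}` with full `(d-1)`-dimensional skeleton whose
`d`-dimensional faces are the members of `S` with `d + 1` elements. -/
def complexOfFaces (n d : ℕ) (S : Set (Finset (Fin n))) : PreAbstractSimplicialComplex (Fin n) where
  faces := {s | s.Nonempty ∧ (s.card ≤ d ∨ (s.card = d + 1 ∧ s ∈ S))}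
  isRelLowerSet_faces := by
    rintro s ⟨hs, h⟩
    refine ⟨hs, fun t hts ht => ⟨ht, ?_⟩⟩
    rcases h with h | ⟨h, hS⟩
    · exact Or.inl ((Finset.card_le_card hts).trans h)
    · rcases eq_or_ne t s with rfl | hne
      · exact Or.inr ⟨h, hS⟩
      · have := Finset.card_lt_card (lt_of_le_of_ne hts hne)
        exact Or.inl (by omega)

/-- The law of the set of `d`-dimensional faces of `X_d(n, p)`: each `(d+1)`-subset of the vertex
set is chosen independently with probability `p`. -/
def faceLaw (n d : ℕ) (p : unitInterval) : Measure (Set (Finset (Fin n))) :=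
  setBernoulli {s | s.card = d + 1} p

/-- The probability that `X ∼ X_d(n, p)` satisfies `H_d(X; F) ≠ 0`. -/
def probHomologyNeZero (F : Type*) [Field F] (n d : ℕ) (p : unitInterval) : ENNReal :=
  faceLaw n d p {S | Nontrivial (Homology F (complexOfFaces n d S) d)}

/-! ### The critical values -/

/-- `b` is a root in `(0, 1)` of `-ln (1 - b) = (d + 1) b / (d + 1 - d b)`. -/
def IsCriticalRoot (d : ℕ) (b : ℝ) : Prop :=
  (0 < b ∧ b < 1) ∧ -Real.log (1 - b) = ((d : ℝ) + 1) * b / ((d : ℝ) + 1 - d * b)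

/-- `-ln (1 - b) / b ^ d`, which is `c*_d` for `b = β_d`. -/
def criticalValue (d : ℕ) (b : ℝ) : ℝ := -Real.log (1 - b) / b ^ d

end RandomComplex

end

/-! Homology in degree `d` is nonzero as soon as there are more `d`-faces than the rank of the
boundary operator. The difference, `nullity`, changes by at most 1 when one face is toggled, so by
Efron–Stein its variance is at most the expected number of faces, which is O(n^d). By Chebyshev it
therefore suffices that its mean is at least a constant times n^d.

The mean is found by integrating the rank over the parameter. Adding a face σ raises the rank
exactly when the boundary of σ is outside the span of the other boundaries, and this becomes rarer
as the complex grows (`antitone_marginal_boundaryRank`, `sum_marginal_le_avg_sub`). If σ is spanned,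
it lies in the support of a cycle. That support has no free side, so every side of σ survives any
number of rounds of collapsing, unless the neighbourhood of σ contains a dense family, that is, one
with fewer new vertices than faces (`escapesSpan_of_dead`). Dense families have probability O(1/n).
Hence the sides are almost independent, and at p = t/n each survives `r` rounds with probability
asymptotically at most `survival d t r`, a branching-process recursion (`eventually_alive_le`). Its
limit is at most q, where t = `criticalValue d q`.

So between t and t + dt the rank grows by at least about (1 - q^(d+1)) dt · C(n,d)/(d+1), while it
never exceeds C(n,d). Integrating downwards from t = ∞ bounds the rank at c/n from above by about
`rankDensity d q` · C(n,d). The number of faces is about c/(d+1) · C(n,d). The surplus is `rootFun d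
q` / (d+1) times C(n,d), and it is positive exactly because q lies beyond the critical root.

The numerical values follow from sign changes of `rootFun` at rational points. The expansions follow
from the fixed-point form x = e^(-(d+1)) exp((d+1)²x/(1+dx)) of the root equation, with x = 1 - β.
-/

namespace RandomComplex

/-! ### Averaging over independent Bernoulli coordinates -/

section Average

variable {ι : Type*} [DecidableEq ι]

/-- The average of `f` when every coordinate in the list is resampled, being put into the set with
probability `p` and removed from it otherwise. -/
noncomputable def avg (p : ℝ) : List ι → (Finset ι → ℝ) → Finset ι → ℝ
  | [], f => f
  | i :: l, f => fun X => p * avg p l f (insert i X) + (1 - p) * avg p l f (X.erase i)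

/-- The marginal value of the coordinate `i`. -/
def marginal (f : Finset ι → ℝ) (i : ι) (X : Finset ι) : ℝ := f (insert i X) - f (X.erase i)

variable {p : ℝ} {l : List ι} {f g : Finset ι → ℝ}

lemma avg_mono (h0 : 0 ≤ p) (h1 : p ≤ 1) (h : ∀ X, f X ≤ g X) (X : Finset ι) :
    avg p l f X ≤ avg p l g X := by
  induction l generalizing X with
  | nil => exact h X
  | cons i l ih =>
    exact add_le_add (mul_le_mul_of_nonneg_left (ih _) h0)
      (mul_le_mul_of_nonneg_left (ih _) (by linarith))

lemma avg_const (a : ℝ) (X : Finset ι) : avg p l (fun _ => a) X = a := by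
  induction l generalizing X with
  | nil => rfl
  | cons i l ih => simp only [avg, ih]; ring

lemma avg_add (X : Finset ι) : avg p l (fun X => f X + g X) X = avg p l f X + avg p l g X := by
  induction l generalizing X with
  | nil => rfl
  | cons i l ih => simp only [avg, ih]; ring

lemma avg_const_mul (a : ℝ) (X : Finset ι) : avg p l (fun X => a * f X) X = a * avg p l f X := by
  induction l generalizing X with
  | nil => rfl
  | cons i l ih => simp only [avg, ih]; ring

lemma avg_neg (X : Finset ι) : avg p l (fun X => -f X) X = -avg p l f X := by
  simpa using avg_const_mul (p := p) (l := l) (f := f) (-1) X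

lemma avg_sub (X : Finset ι) : avg p l (fun X => f X - g X) X = avg p l f X - avg p l g X := by
  simp only [sub_eq_add_neg]
  rw [avg_add, avg_neg]

lemma avg_sum {κ : Type*} (s : Finset κ) (F : κ → Finset ι → ℝ) (X : Finset ι) :
    avg p l (fun X => ∑ k ∈ s, F k X) X = ∑ k ∈ s, avg p l (F k) X := by
  classical
  induction s using Finset.induction_on with
  | empty => simpa using avg_const (p := p) (l := l) 0 X
  | insert a s ha ih => simp only [Finset.sum_insert ha, avg_add, ih]

lemma avg_nonneg (h0 : 0 ≤ p) (h1 : p ≤ 1) (h : ∀ X, 0 ≤ f X) (X : Finset ι) :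
    0 ≤ avg p l f X := by
  simpa [avg_const] using avg_mono (l := l) h0 h1 (f := fun _ => 0) h X

lemma avg_le_of_le (h0 : 0 ≤ p) (h1 : p ≤ 1) {a : ℝ} (h : ∀ X, f X ≤ a) (X : Finset ι) :
    avg p l f X ≤ a := by
  simpa [avg_const] using avg_mono (l := l) h0 h1 (g := fun _ => a) h X

lemma avg_monotone (h0 : 0 ≤ p) (h1 : p ≤ 1) (hf : Monotone f) : Monotone (avg p l f) := by
  induction l with
  | nil => exact hf
  | cons i l ih =>
    intro X Y h
    exact add_le_add (mul_le_mul_of_nonneg_left (ih (Finset.insert_subset_insert i h)) h0)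
      (mul_le_mul_of_nonneg_left (ih (Finset.erase_subset_erase i h)) (by linarith))

lemma avg_antitone (h0 : 0 ≤ p) (h1 : p ≤ 1) (hf : Antitone f) : Antitone (avg p l f) := by
  intro X Y h
  have := avg_monotone (l := l) h0 h1 hf.neg h
  have e := fun X => avg_neg (p := p) (l := l) (f := f) X
  simp only [e] at this
  linarith

lemma avg_insert {i : ι} (hi : i ∉ l) (X : Finset ι) :
    avg p l f (insert i X) = avg p l (fun Y => f (insert i Y)) X := by
  induction l generalizing X with
  | nil => rfl
  | cons j l ih =>
    have hj : i ≠ j ∧ i ∉ l := by simpa using hi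
    simp only [avg]
    rw [Finset.insert_comm, ih hj.2, Finset.erase_insert_of_ne hj.1, ih hj.2]

lemma avg_erase {i : ι} (hi : i ∉ l) (X : Finset ι) :
    avg p l f (X.erase i) = avg p l (fun Y => f (Y.erase i)) X := by
  induction l generalizing X with
  | nil => rfl
  | cons j l ih =>
    have hj : i ≠ j ∧ i ∉ l := by simpa using hi
    simp only [avg]
    rw [← Finset.erase_insert_of_ne hj.1.symm, ih hj.2, Finset.erase_right_comm, ih hj.2]

lemma marginal_avg {i : ι} (hi : i ∉ l) (X : Finset ι) :
    marginal (avg p l f) i X = avg p l (marginal f i) X := by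
  unfold marginal
  rw [avg_insert hi, avg_erase hi, ← avg_sub]

lemma avg_insert_of_indep {i : ι} (h : ∀ X, f (insert i X) = f X) (X : Finset ι) :
    avg p l f (insert i X) = avg p l f X := by
  induction l generalizing X with
  | nil => exact h X
  | cons j l ih =>
    simp only [avg]
    rw [Finset.insert_comm, ih]
    rcases eq_or_ne i j with rfl | hij
    · rw [Finset.erase_insert_eq_erase]
    · rw [Finset.erase_insert_of_ne hij, ih]

lemma avg_erase_of_indep {i : ι} (h : ∀ X, f (insert i X) = f X) (X : Finset ι) :
    avg p l f (X.erase i) = avg p l f X := by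
  rw [← avg_insert_of_indep h (X.erase i), ← avg_insert_of_indep h X]
  congr 1
  ext j
  by_cases hj : j = i <;> simp [hj]

lemma avg_cons_of_indep {i : ι} (h : ∀ X, f (insert i X) = f X) (X : Finset ι) :
    avg p (i :: l) f X = avg p l f X := by
  simp only [avg]
  rw [avg_insert_of_indep h, avg_erase_of_indep h]
  ring

/-- The presence of `i` is independent of a function that ignores `i`. -/
lemma avg_ite_mem (hl : l.Nodup) {i : ι} (hi : i ∈ l) (h : ∀ X, f (insert i X) = f X)
    (X : Finset ι) :
    avg p l (fun X => if i ∈ X then f X else 0) X = p * avg p l f X := by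
  induction l generalizing X with
  | nil => simp at hi
  | cons j l ih =>
    have hl' := List.nodup_cons.1 hl
    rcases eq_or_ne i j with rfl | hij
    · rw [avg_cons_of_indep h]
      simp only [avg]
      rw [avg_insert hl'.1, avg_erase hl'.1]
      simp only [Finset.mem_insert_self, if_true, Finset.notMem_erase, if_false, avg_const, h]
      ring
    · have hi' : i ∈ l := by simpa [hij] using hi
      simp only [avg]
      rw [ih hl'.2 hi', ih hl'.2 hi']
      ring

/-- The probability that all of the coordinates in `A` are present. -/
lemma avg_subset (hl : l.Nodup) (A : Finset ι) (hA : ∀ i ∈ A, i ∈ l) (X : Finset ι) :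
    avg p l (fun X => if A ⊆ X then 1 else 0) X = p ^ A.card := by
  induction A using Finset.induction_on with
  | empty => simp [avg_const]
  | insert i A hi ih =>
    rw [Finset.card_insert_of_notMem hi, pow_succ',
      ← ih (fun j hj => hA j (Finset.mem_insert_of_mem hj)),
      ← avg_ite_mem hl (hA i (Finset.mem_insert_self _ _))]
    · congr 1
      funext Y
      by_cases h1 : i ∈ Y <;> simp [Finset.insert_subset_iff, h1]
    · intro Y
      have : A ⊆ insert i Y ↔ A ⊆ Y := Finset.subset_insert_iff_of_notMem hi
      simp [this]

/-- The Harris inequality. -/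
lemma avg_mul_le_of_monotone (h0 : 0 ≤ p) (h1 : p ≤ 1) (hf : Monotone f) (hg : Monotone g)
    (X : Finset ι) : avg p l f X * avg p l g X ≤ avg p l (fun X => f X * g X) X := by
  induction l generalizing X with
  | nil => exact le_rfl
  | cons i l ih =>
    have hs : X.erase i ⊆ insert i X := (Finset.erase_subset _ _).trans (Finset.subset_insert _ _)
    have a := avg_monotone (l := l) h0 h1 hf hs
    have b := avg_monotone (l := l) h0 h1 hg hs
    have c := mul_le_mul_of_nonneg_left (ih (insert i X)) h0
    have e := mul_le_mul_of_nonneg_left (ih (X.erase i)) (sub_nonneg.2 h1)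
    simp only [avg]
    -- Resampling one coordinate adds p(1-p) times the product of the two marginals to the
    -- covariance. Both marginals are nonnegative here.
    nlinarith [mul_nonneg (mul_nonneg h0 (sub_nonneg.2 h1)) (mul_nonneg (sub_nonneg.2 a)
      (sub_nonneg.2 b))]

lemma avg_mul_le_of_antitone (h0 : 0 ≤ p) (h1 : p ≤ 1) (hf : Antitone f) (hg : Antitone g)
    (X : Finset ι) : avg p l f X * avg p l g X ≤ avg p l (fun X => f X * g X) X := by
  have := avg_mul_le_of_monotone (l := l) h0 h1 hf.neg hg.neg X
  have e := fun (f : Finset ι → ℝ) X => avg_neg (p := p) (l := l) (f := f) X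
  simpa only [Pi.neg_def, e, neg_mul_neg] using this

/-- Iterated Harris inequality: a product of nonnegative decreasing functions is again decreasing.
-/
lemma prod_avg_le_of_antitone {κ : Type*} (h0 : 0 ≤ p) (h1 : p ≤ 1) (s : Finset κ)
    (F : κ → Finset ι → ℝ) (hF : ∀ k ∈ s, Antitone (F k)) (hF0 : ∀ k ∈ s, ∀ X, 0 ≤ F k X)
    (X : Finset ι) :
    ∏ k ∈ s, avg p l (F k) X ≤ avg p l (fun X => ∏ k ∈ s, F k X) X := by
  classical
  induction s using Finset.induction_on with
  | empty => simp [avg_const]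
  | insert a s ha ih =>
    have hs := fun k hk => hF k (Finset.mem_insert_of_mem hk)
    have hs0 := fun k hk => hF0 k (Finset.mem_insert_of_mem hk)
    have ha1 := hF a (Finset.mem_insert_self _ _)
    have ha0 := hF0 a (Finset.mem_insert_self _ _)
    simp only [Finset.prod_insert ha]
    refine (mul_le_mul_of_nonneg_left (ih hs hs0) (avg_nonneg h0 h1 ha0 X)).trans ?_
    refine avg_mul_le_of_antitone h0 h1 ha1 ?_ X
    intro Y Z hYZ
    exact Finset.prod_le_prod (fun k hk => hs0 k hk _) fun k hk => hs k hk hYZ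

/-- The covariance of two increasing functions is at most the expected number of present
coordinates that may be pivotal for both. -/
lemma avg_mul_sub_le (h0 : 0 ≤ p) (h1 : p ≤ 1) (hl : l.Nodup) (hf : Monotone f) (hg : Monotone g)
    (a b : ι → Finset ι → ℝ) (ha : ∀ i, Monotone (a i)) (hb : ∀ i, Monotone (b i))
    (hai : ∀ i X, a i (insert i X) = a i X) (hbi : ∀ i X, b i (insert i X) = b i X)
    (hfa : ∀ i X, marginal f i X ≤ a i X) (hgb : ∀ i X, marginal g i X ≤ b i X) (X : Finset ι) :
    avg p l (fun X => f X * g X) X - avg p l f X * avg p l g X ≤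
      ∑ i ∈ l.toFinset, p * avg p l (fun X => a i X * b i X) X := by
  induction l generalizing X with
  | nil => simp [avg]
  | cons i l ih =>
    have hl' := List.nodup_cons.1 hl
    have hs : X.erase i ⊆ insert i X := (Finset.erase_subset _ _).trans (Finset.subset_insert _ _)
    have u := mul_le_mul_of_nonneg_left (ih hl'.2 (insert i X)) h0
    have v := mul_le_mul_of_nonneg_left (ih hl'.2 (X.erase i)) (sub_nonneg.2 h1)
    have hi : i ∉ l.toFinset := by simpa using hl'.1
    rw [List.toFinset_cons, Finset.sum_insert hi]
    have e1 : ∑ j ∈ l.toFinset, p * avg p (i :: l) (fun X => a j X * b j X) X =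
        p * ∑ j ∈ l.toFinset, p * avg p l (fun X => a j X * b j X) (insert i X) +
        (1 - p) * ∑ j ∈ l.toFinset, p * avg p l (fun X => a j X * b j X) (X.erase i) := by
      rw [Finset.mul_sum, Finset.mul_sum, ← Finset.sum_add_distrib]
      refine Finset.sum_congr rfl fun j _ => ?_
      simp only [avg]
      ring
    -- `a i` and `b i` ignore the coordinate `i`, so resampling it has no effect.
    have e2 : avg p (i :: l) (fun X => a i X * b i X) X = avg p l (fun X => a i X * b i X) X :=
      avg_cons_of_indep (fun X => by rw [hai, hbi]) X
    have A0 : 0 ≤ marginal (avg p l f) i X := sub_nonneg.2 (avg_monotone h0 h1 hf hs)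
    have B0 : 0 ≤ marginal (avg p l g) i X := sub_nonneg.2 (avg_monotone h0 h1 hg hs)
    have A1 : marginal (avg p l f) i X ≤ avg p l (a i) X := by
      rw [marginal_avg hl'.1]; exact avg_mono h0 h1 (hfa i) X
    have B1 : marginal (avg p l g) i X ≤ avg p l (b i) X := by
      rw [marginal_avg hl'.1]; exact avg_mono h0 h1 (hgb i) X
    -- Harris for the increasing bounds turns a product of averages into the average of the product.
    -- The factor 1 - p in the covariance of a single coordinate is then dropped.
    have C : marginal (avg p l f) i X * marginal (avg p l g) i X ≤
        avg p l (fun X => a i X * b i X) X :=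
      (mul_le_mul A1 B1 B0 (A0.trans A1)).trans (avg_mul_le_of_monotone h0 h1 (ha i) (hb i) X)
    have C' : p * (1 - p) * (marginal (avg p l f) i X * marginal (avg p l g) i X) ≤
        p * avg p l (fun X => a i X * b i X) X := by
      have := mul_le_mul_of_nonneg_left C h0
      have := mul_nonneg A0 B0
      nlinarith [mul_nonneg h0 h0]
    rw [e1, e2]
    simp only [avg]
    unfold marginal at C'
    nlinarith

/-- The Efron–Stein bound for functions that change by at most `1` in each coordinate. -/
lemma avg_sq_le (h0 : 0 ≤ p) (h1 : p ≤ 1) (hf : ∀ i X, |marginal f i X| ≤ 1) (X : Finset ι)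
    (hl : l.Nodup) :
    avg p l (fun X => f X ^ 2) X ≤ avg p l f X ^ 2 + l.length * p := by
  induction l generalizing X with
  | nil => simp [avg]
  | cons i l ih =>
    have hl' := List.nodup_cons.1 hl
    have u := mul_le_mul_of_nonneg_left (ih (insert i X) hl'.2) h0
    have v := mul_le_mul_of_nonneg_left (ih (X.erase i) hl'.2) (sub_nonneg.2 h1)
    have A : |marginal (avg p l f) i X| ≤ 1 := by
      rw [marginal_avg hl'.1, abs_le]
      constructor
      · have := avg_mono (l := l) h0 h1 (fun X => (abs_le.1 (hf i X)).1) X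
        rwa [avg_const] at this
      · exact avg_le_of_le h0 h1 (fun X => (abs_le.1 (hf i X)).2) X
    have A2 : marginal (avg p l f) i X ^ 2 ≤ 1 := (sq_le_one_iff_abs_le_one _).2 A
    -- This is the contribution of the coordinate `i` to the variance.
    have A3 : p * (1 - p) * marginal (avg p l f) i X ^ 2 ≤ p := by
      nlinarith [mul_nonneg h0 (sub_nonneg.2 h1), mul_nonneg h0 h0]
    simp only [avg, List.length_cons, Nat.cast_add, Nat.cast_one]
    unfold marginal at A3
    nlinarith

/-- A lower bound for the growth of the average of a function with decreasing marginals. -/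
lemma sum_marginal_le_avg_sub {s t : ℝ} (hs : 0 ≤ s) (hst : s ≤ t) (ht : t ≤ 1) (hl : l.Nodup)
    (hf : ∀ i, Antitone (marginal f i)) (X : Finset ι) :
    (t - s) * ∑ i ∈ l.toFinset, avg t l (marginal f i) X ≤ avg t l f X - avg s l f X := by
  have ht0 := hs.trans hst
  have hmi : ∀ i X, marginal f i (insert i X) = marginal f i X := by
    intro i X
    simp [marginal, Finset.erase_insert_eq_erase]
  induction l generalizing X with
  | nil => simp [avg]
  | cons i l ih =>
    have hl' := List.nodup_cons.1 hl
    have hss : X.erase i ⊆ insert i X := (Finset.erase_subset _ _).trans (Finset.subset_insert _ _)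
    have hi : i ∉ l.toFinset := by simpa using hl'.1
    have u := mul_le_mul_of_nonneg_left (ih hl'.2 (insert i X)) hs
    have v := mul_le_mul_of_nonneg_left (ih hl'.2 (X.erase i)) (sub_nonneg.2 (hst.trans ht))
    rw [List.toFinset_cons, Finset.sum_insert hi, avg_cons_of_indep (hmi i), ← marginal_avg hl'.1]
    -- Marginals decrease when `i` is inserted, so weighting the inserted case by `s` instead of `t`
    -- can only increase the sum.
    have w : ∑ j ∈ l.toFinset, avg t (i :: l) (marginal f j) X ≤
        s * ∑ j ∈ l.toFinset, avg t l (marginal f j) (insert i X) +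
        (1 - s) * ∑ j ∈ l.toFinset, avg t l (marginal f j) (X.erase i) := by
      rw [Finset.mul_sum, Finset.mul_sum, ← Finset.sum_add_distrib]
      refine Finset.sum_le_sum fun j _ => ?_
      have := avg_antitone (l := l) ht0 ht (hf j) hss
      simp only [avg]
      nlinarith [mul_nonneg (sub_nonneg.2 hst) (sub_nonneg.2 this)]
    have w' := mul_le_mul_of_nonneg_left w (sub_nonneg.2 hst)
    simp only [avg]
    simp only [avg] at w'
    unfold marginal at *
    nlinarith

/-- The average as a finite sum. -/
lemma avg_eq_sum_powerset (hl : l.Nodup) (X : Finset ι) :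
    avg p l f X = ∑ A ∈ l.toFinset.powerset,
      p ^ A.card * (1 - p) ^ (l.toFinset \ A).card * f (A ∪ X \ l.toFinset) := by
  induction l generalizing X with
  | nil => simp [avg]
  | cons i l ih =>
    have hl' := List.nodup_cons.1 hl
    have hi : i ∉ l.toFinset := by simpa using hl'.1
    rw [List.toFinset_cons, Finset.sum_powerset_insert hi, add_comm]
    simp only [avg]
    rw [ih hl'.2, ih hl'.2, Finset.mul_sum, Finset.mul_sum]
    congr 1
    · refine Finset.sum_congr rfl fun A hA => ?_
      have hA' : A ⊆ l.toFinset := Finset.mem_powerset.1 hA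
      have hiA : i ∉ A := fun h => hi (hA' h)
      have e1 : insert i l.toFinset \ insert i A = l.toFinset \ A := by
        ext j; by_cases hj : j = i <;> simp_all
      have e2 : insert i A ∪ X \ insert i l.toFinset = A ∪ insert i X \ l.toFinset := by
        ext j; by_cases hj : j = i <;> simp_all
      rw [e1, e2, Finset.card_insert_of_notMem hiA]
      ring
    · refine Finset.sum_congr rfl fun A hA => ?_
      have hA' : A ⊆ l.toFinset := Finset.mem_powerset.1 hA
      have hiA : i ∉ A := fun h => hi (hA' h)
      have e1 : insert i l.toFinset \ A = insert i (l.toFinset \ A) := by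
        ext j; by_cases hj : j = i <;> simp_all
      have e2 : A ∪ X \ insert i l.toFinset = A ∪ X.erase i \ l.toFinset := by
        ext j; by_cases hj : j = i <;> simp_all
      rw [e1, e2, Finset.card_insert_of_notMem (by simp [hi])]
      ring

end Average

/-! ### Local exploration of a uniform hypergraph -/

section Exploration

variable {V : Type*} [DecidableEq V]

/-- The face `τ` survives `r` rounds of collapsing in the part of `X` explored from `τ` through
vertices outside of `S`. -/
def Alive : ℕ → Finset V → Finset V → Finset (Finset V) → Prop
  | 0, _, _, _ => True
  | r + 1, τ, S, X => ∃ w ∉ S, insert w τ ∈ X ∧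
      ∀ u ∈ τ, Alive r ((insert w τ).erase u) (insert w S) X

/-- The face `i` can be reached from `τ` in at most `r` steps of the exploration of `X`. -/
def Reach : ℕ → Finset V → Finset V → Finset V → Finset (Finset V) → Prop
  | 0, _, _, _, _ => False
  | r + 1, τ, S, i, X => ∃ w ∉ S, insert w τ = i ∨ (insert w τ ∈ X ∧
      ∃ u ∈ τ, Reach r ((insert w τ).erase u) (insert w S) i X)

/-- A family of at most `m` faces of dimension `d` with fewer vertices outside of `S` than
members. -/
def IsDense (d m : ℕ) (S : Finset V) (Q : Finset (Finset V)) : Prop :=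
  Q.card ≤ m ∧ (∀ q ∈ Q, q.card = d + 1) ∧ (Q.biUnion id \ S).card < Q.card

/-! ### Monotonicity and locality of the exploration, and the families of faces it traces -/

variable {d m r : ℕ} {τ S σ i : Finset V} {X Y : Finset (Finset V)}

lemma Alive.mono (hXY : X ⊆ Y) (h : Alive r τ S X) : Alive r τ S Y := by
  induction r generalizing τ S with
  | zero => trivial
  | succ r ih =>
    obtain ⟨w, hw, hX, h⟩ := h
    exact ⟨w, hw, hXY hX, fun u hu => ih (h u hu)⟩

lemma Reach.mono (hXY : X ⊆ Y) (h : Reach r τ S i X) : Reach r τ S i Y := by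
  induction r generalizing τ S with
  | zero => exact h
  | succ r ih =>
    obtain ⟨w, hw, h⟩ := h
    refine ⟨w, hw, h.imp_right fun ⟨hX, u, hu, h⟩ => ⟨hXY hX, u, hu, ih h⟩⟩

/-- Each face queried by the exploration contains a vertex outside `S`, so a face inside `S` is
never looked at. -/
lemma Alive.of_insert (hi : i ⊆ S) (h : Alive r τ S (insert i X)) : Alive r τ S X := by
  induction r generalizing τ S with
  | zero => trivial
  | succ r ih =>
    obtain ⟨w, hw, hX, h⟩ := h
    refine ⟨w, hw, ?_, fun u hu => ih (hi.trans (Finset.subset_insert _ _)) (h u hu)⟩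
    rcases Finset.mem_insert.1 hX with e | hX
    · exact absurd (hi (e ▸ Finset.mem_insert_self w τ)) hw
    · exact hX

lemma alive_insert_iff (hi : i ⊆ S) : Alive r τ S (insert i X) ↔ Alive r τ S X :=
  ⟨Alive.of_insert hi, Alive.mono (Finset.subset_insert _ _)⟩

/-- Keep the witness `w` that works in the presence of `i`. Without `i` it fails, so either its face
is `i` or `i` is pivotal for one of the next sides. -/
lemma reach_of_pivotal (h : Alive r τ S (insert i X)) (h' : ¬ Alive r τ S (X.erase i)) :
    Reach r τ S i (X.erase i) := by
  induction r generalizing τ S with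
  | zero => exact absurd trivial h'
  | succ r ih =>
    obtain ⟨w, hw, hX, h⟩ := h
    refine ⟨w, hw, ?_⟩
    by_cases e : insert w τ = i
    · exact Or.inl e
    · have hX' : insert w τ ∈ X.erase i :=
        Finset.mem_erase.2 ⟨e, (Finset.mem_insert.1 hX).resolve_left e⟩
      by_contra hcon
      push Not at hcon
      refine h' ⟨w, hw, hX', fun u hu => ?_⟩
      by_contra hd
      exact hcon.2 hX' u hu (ih (h u hu) hd)

lemma card_erase_insert {w u : V} (hd : τ.card = d) (hw : w ∉ τ) (hu : u ∈ τ) :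
    ((insert w τ).erase u).card = d := by
  rw [Finset.card_erase_of_mem (Finset.mem_insert_of_mem hu), Finset.card_insert_of_notMem hw, hd]
  rfl

lemma erase_insert_subset {w u : V} (hτ : τ ⊆ S) : (insert w τ).erase u ⊆ insert w S :=
  (Finset.erase_subset _ _).trans (Finset.insert_subset_insert w hτ)

/-- The family is the path of faces from `τ` to `i`. Each step adds a new face and at most one
vertex outside `S`. Only `i` itself may be missing from `X`. The clause `q ∩ S ⊆ τ` records that the
path meets `S` only through its starting side, which distinguishes it from a path starting at
another side. -/
lemma exists_path_of_reach (hτ : τ ⊆ S) (hd : τ.card = d) (h : Reach r τ S i X) :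
    ∃ Q : Finset (Finset V), i ∈ Q ∧ Q.erase i ⊆ X ∧ Q.card ≤ r ∧ (∀ q ∈ Q, q.card = d + 1) ∧
      (Q.biUnion id \ S).card ≤ Q.card ∧ (∀ q ∈ Q, q ∩ S ⊆ τ) ∧ ∀ q ∈ Q, ¬ q ⊆ S := by
  induction r generalizing τ S with
  | zero => exact h.elim
  | succ r ih =>
    obtain ⟨w, hw, h⟩ := h
    have hwτ : w ∉ τ := fun h => hw (hτ h)
    have hcard : (insert w τ).card = d + 1 := by rw [Finset.card_insert_of_notMem hwτ, hd]
    have hint : insert w τ ∩ S ⊆ τ := by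
      intro x hx
      rw [Finset.mem_inter, Finset.mem_insert] at hx
      rcases hx with ⟨rfl | hx, hS⟩
      · exact absurd hS hw
      · exact hx
    rcases h with rfl | ⟨hX, u, hu, h⟩
    · refine ⟨{insert w τ}, by simp, by simp, by simp, by simpa using hcard, ?_, by simpa using hint,
        fun q hq hqS => ?_⟩
      · have : ({insert w τ} : Finset (Finset V)).biUnion id \ S ⊆ {w} := by
          intro x hx
          simp only [Finset.singleton_biUnion, id, Finset.mem_sdiff, Finset.mem_insert] at hx
          rcases hx with ⟨rfl | hx, hS⟩
          · simp
          · exact absurd (hτ hx) hS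
        simpa using Finset.card_le_card this
      · rw [Finset.mem_singleton] at hq
        exact hw (hqS (hq ▸ Finset.mem_insert_self w τ))
    · obtain ⟨Q, hiQ, hQX, hQr, hQd, hQS, hQτ, hQn⟩ :=
        ih (erase_insert_subset hτ) (card_erase_insert hd hwτ hu) h
      have hnew : insert w τ ∉ Q := fun h => hQn _ h (Finset.insert_subset_insert w hτ)
      refine ⟨insert (insert w τ) Q, Finset.mem_insert_of_mem hiQ, ?_, ?_, ?_, ?_, ?_, ?_⟩
      · intro q hq
        rw [Finset.mem_erase, Finset.mem_insert] at hq
        rcases hq with ⟨hqi, rfl | hq⟩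
        · exact hX
        · exact hQX (Finset.mem_erase.2 ⟨hqi, hq⟩)
      · rw [Finset.card_insert_of_notMem hnew]; omega
      · simpa [hcard] using hQd
      · rw [Finset.card_insert_of_notMem hnew]
        have : (insert (insert w τ) Q).biUnion id \ S ⊆ insert w (Q.biUnion id \ insert w S) := by
          intro x hx
          rw [Finset.biUnion_insert, Finset.mem_sdiff, Finset.mem_union] at hx
          by_cases hxw : x = w
          · simp [hxw]
          · refine Finset.mem_insert_of_mem (Finset.mem_sdiff.2 ?_)
            rcases hx with ⟨hx | hx, hS⟩
            · exact absurd (hτ ((Finset.mem_insert.1 hx).resolve_left hxw)) hS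
            · exact ⟨hx, by simp [hxw, hS]⟩
        exact (Finset.card_le_card this).trans ((Finset.card_insert_le _ _).trans (by omega))
      · intro q hq
        rcases Finset.mem_insert.1 hq with rfl | hq
        · exact hint
        · intro x hx
          rw [Finset.mem_inter] at hx
          have h1 := hQτ q hq (Finset.mem_inter.2 ⟨hx.1, Finset.mem_insert_of_mem hx.2⟩)
          rcases Finset.mem_insert.1 (Finset.mem_of_mem_erase h1) with rfl | h2
          · exact absurd hx.2 hw
          · exact h2
      · intro q hq hqS
        rcases Finset.mem_insert.1 hq with rfl | hq
        · exact hw (hqS (Finset.mem_insert_self _ _))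
        · exact hQn q hq (hqS.trans (Finset.subset_insert _ _))

/-- A second exploration, from a side `τ` contained in no face of the first path `Q₁`, also leads to
`i`. As long as it only uses vertices not yet covered, its sides stay out of all members of `Q₁`, so
it cannot arrive at `i`. It must therefore use a covered vertex, and that step adds a face without
adding a vertex. -/
lemma exists_dense_of_reach {S₀ : Finset V} {Q₁ Q : Finset (Finset V)} (hi : i ∈ Q₁)
    (hQ₁ : Q₁ ⊆ Q) (hτQ : ∀ q ∈ Q₁, ¬ τ ⊆ q) (hτ : τ ⊆ S) (hd : τ.card = d)
    (hS : S ⊆ S₀ ∪ Q.biUnion id) (hS₀ : S₀ ⊆ S) (hQS : ∀ q ∈ Q, q ∉ Q₁ → q ⊆ S)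
    (hQd : ∀ q ∈ Q, q.card = d + 1) (hQc : (Q.biUnion id \ S₀).card ≤ Q.card)
    (hQX : Q.erase i ⊆ X) (h : Reach r τ S i X) :
    ∃ Q' : Finset (Finset V), IsDense d (Q.card + r) S₀ Q' ∧ i ∈ Q' ∧ Q'.erase i ⊆ X := by
  induction r generalizing τ S Q with
  | zero => exact h.elim
  | succ r ih =>
    obtain ⟨w, hw, h⟩ := h
    have hwτ : w ∉ τ := fun h => hw (hτ h)
    rcases h with rfl | ⟨hX, u, hu, h⟩
    · exact absurd (Finset.subset_insert _ _) (hτQ _ hi)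
    have hcard : (insert w τ).card = d + 1 := by rw [Finset.card_insert_of_notMem hwτ, hd]
    have hnew : insert w τ ∉ Q := by
      intro hq
      by_cases hq1 : insert w τ ∈ Q₁
      · exact hτQ _ hq1 (Finset.subset_insert _ _)
      · exact hw (hQS _ hq hq1 (Finset.mem_insert_self _ _))
    have hX' : (insert (insert w τ) Q).erase i ⊆ X := by
      intro q hq
      rw [Finset.mem_erase, Finset.mem_insert] at hq
      rcases hq with ⟨hqi, rfl | hq⟩
      · exact hX
      · exact hQX (Finset.mem_erase.2 ⟨hqi, hq⟩)
    have hd' : ∀ q ∈ insert (insert w τ) Q, q.card = d + 1 := by simpa [hcard] using hQd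
    have hsub : (insert (insert w τ) Q).biUnion id \ S₀ ⊆ insert w (Q.biUnion id \ S₀) := by
      intro x hx
      rw [Finset.biUnion_insert, Finset.mem_sdiff, Finset.mem_union] at hx
      by_cases hxw : x = w
      · simp [hxw]
      · refine Finset.mem_insert_of_mem (Finset.mem_sdiff.2 ⟨?_, hx.2⟩)
        rcases hx with ⟨hx | hx, hxS⟩
        · have := hS (hτ ((Finset.mem_insert.1 hx).resolve_left hxw))
          exact (Finset.mem_union.1 this).resolve_left hxS
        · exact hx
    -- A covered `w` closes a cycle and gives the strict inequality. Otherwise the path is extended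
    -- and the vertex balance is kept.
    by_cases hwQ : w ∈ Q.biUnion id
    · refine ⟨insert (insert w τ) Q, ⟨?_, hd', ?_⟩, Finset.mem_insert_of_mem (hQ₁ hi), hX'⟩
      · rw [Finset.card_insert_of_notMem hnew]; omega
      · rw [Finset.card_insert_of_notMem hnew, Nat.lt_succ_iff]
        refine le_trans (Finset.card_le_card ?_) hQc
        have hwm : w ∈ Q.biUnion id \ S₀ := Finset.mem_sdiff.2 ⟨hwQ, fun h => hw (hS₀ h)⟩
        exact hsub.trans (Finset.insert_eq_of_mem hwm).le
    · have key := ih (Q := insert (insert w τ) Q) (τ := (insert w τ).erase u) (S := insert w S)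
        (hQ₁.trans (Finset.subset_insert _ _)) ?_ (erase_insert_subset hτ)
        (card_erase_insert hd hwτ hu) ?_ (hS₀.trans (Finset.subset_insert _ _)) ?_ hd' ?_ hX' h
      · rw [Finset.card_insert_of_notMem hnew] at key
        rwa [show Q.card + (r + 1) = Q.card + 1 + r by ring]
      · intro q hq hsubq
        refine hwQ (Finset.mem_biUnion.2 ⟨q, hQ₁ hq, hsubq (Finset.mem_erase.2 ⟨?_, ?_⟩)⟩)
        · rintro rfl; exact hwτ hu
        · exact Finset.mem_insert_self _ _
      · rw [Finset.biUnion_insert]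
        intro x hx
        rcases Finset.mem_insert.1 hx with rfl | hx
        · simp
        · rcases Finset.mem_union.1 (hS hx) with h | h
          · exact Finset.mem_union_left _ h
          · exact Finset.mem_union_right _ (Finset.mem_union_right _ h)
      · intro q hq hq1
        rcases Finset.mem_insert.1 hq with rfl | hq
        · exact Finset.insert_subset_insert w hτ
        · exact (hQS q hq hq1).trans (Finset.subset_insert _ _)
      · rw [Finset.card_insert_of_notMem hnew]
        exact (Finset.card_le_card hsub).trans ((Finset.card_insert_le _ _).trans (by omega))

/-- A face reached from two different sides of a simplex lies in a dense family. -/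
lemma exists_dense_of_reach_of_reach {u v : V} (hσ : σ ⊆ S) (hd : σ.card = d + 1) (hu : u ∈ σ)
    (hv : v ∈ σ) (huv : u ≠ v) (h₁ : Reach r (σ.erase u) S i X) (h₂ : Reach r (σ.erase v) S i X) :
    ∃ Q : Finset (Finset V), IsDense d (2 * r) S Q ∧ i ∈ Q ∧ Q.erase i ⊆ X := by
  have hcu : (σ.erase u).card = d := by rw [Finset.card_erase_of_mem hu, hd]; rfl
  have hcv : (σ.erase v).card = d := by rw [Finset.card_erase_of_mem hv, hd]; rfl
  obtain ⟨Q₁, hiQ, hQX, hQr, hQd, hQS, hQτ, -⟩ :=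
    exists_path_of_reach ((Finset.erase_subset _ _).trans hσ) hcu h₁
  obtain ⟨Q, ⟨h1, h2, h3⟩, h4⟩ := exists_dense_of_reach (S₀ := S) (Q := Q₁) hiQ subset_rfl (by
    intro q hq hsub
    -- The first path meets `S` inside `σ.erase u`, so none of its faces contains the other side,
    -- which has `u` as a vertex.
    have h1 : u ∈ q ∩ S := Finset.mem_inter.2 ⟨hsub (Finset.mem_erase.2 ⟨huv, hu⟩), hσ hu⟩
    exact Finset.notMem_erase u σ (hQτ q hq h1)) ((Finset.erase_subset _ _).trans hσ) hcv
    Finset.subset_union_left subset_rfl (fun q hq hq' => absurd hq hq') hQd hQS hQX h₂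
  exact ⟨Q, ⟨by omega, h2, h3⟩, h4⟩

/-- In a family without free faces every side of a member stays alive, unless there is a dense
family near this member. -/
lemma alive_of_core {σ₀ : Finset V} {Z : Set (Finset V)} {Q : Finset (Finset V)} {u : V}
    (hZ : ∀ σ ∈ Z, ∀ u ∈ σ, ∃ w ∉ σ, insert w (σ.erase u) ∈ Z)
    (hZX : ∀ σ ∈ Z, σ = σ₀ ∨ σ ∈ X) (hZd : ∀ σ ∈ Z, σ.card = d + 1)
    (hX : ∀ Q ⊆ X, ¬ IsDense d m σ₀ Q) (hσ : σ ∈ Z) (hu : u ∈ σ) (hσS : σ ⊆ S)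
    (hS : S = σ₀ ∪ Q.biUnion id) (hQX : Q ⊆ X) (hQd : ∀ q ∈ Q, q.card = d + 1)
    (hQc : (Q.biUnion id \ σ₀).card ≤ Q.card) (hQr : Q.card + r ≤ m)
    (hQσ : ∀ q ∈ Q, σ.erase u ⊆ q → q = σ) (hσ₀ : σ.erase u ⊆ σ₀ → σ₀ = σ) :
    Alive r (σ.erase u) S X := by
  induction r generalizing σ S Q u with
  | zero => trivial
  | succ r ih =>
    obtain ⟨w, hwσ, hw⟩ := hZ σ hσ u hu
    have hne : insert w (σ.erase u) ≠ σ := fun h => hwσ (h ▸ Finset.mem_insert_self _ _)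
    have hsub : σ.erase u ⊆ insert w (σ.erase u) := Finset.subset_insert _ _
    have hnew : insert w (σ.erase u) ∉ Q := fun h => hne (hQσ _ h hsub)
    have hmem : insert w (σ.erase u) ∈ X := by
      refine (hZX _ hw).resolve_left fun h => ?_
      rw [h] at hsub hne
      exact hne (hσ₀ hsub)
    have hX' : insert (insert w (σ.erase u)) Q ⊆ X := Finset.insert_subset hmem hQX
    have hd' : ∀ q ∈ insert (insert w (σ.erase u)) Q, q.card = d + 1 := by
      simpa [hZd _ hw] using hQd
    have hcard : (insert (insert w (σ.erase u)) Q).card = Q.card + 1 :=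
      Finset.card_insert_of_notMem hnew
    have hcov : (insert (insert w (σ.erase u)) Q).biUnion id \ σ₀ ⊆
        insert w (Q.biUnion id \ σ₀) := by
      intro x hx
      rw [Finset.biUnion_insert, Finset.mem_sdiff, Finset.mem_union] at hx
      by_cases hxw : x = w
      · simp [hxw]
      · refine Finset.mem_insert_of_mem (Finset.mem_sdiff.2 ⟨?_, hx.2⟩)
        rcases hx with ⟨hx | hx, hxS⟩
        · have := hσS (Finset.mem_of_mem_erase ((Finset.mem_insert.1 hx).resolve_left hxw))
          rw [hS] at this
          exact (Finset.mem_union.1 this).resolve_left hxS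
        · exact hx
    -- A repeated vertex would make the explored family dense: one more face and no new vertex.
    have hwS : w ∉ S := by
      intro hwS
      refine hX _ hX' ⟨by omega, hd', ?_⟩
      rw [hcard, Nat.lt_succ_iff]
      refine le_trans (Finset.card_le_card ?_) hQc
      intro x hx
      rcases Finset.mem_insert.1 (hcov hx) with rfl | h
      · rw [hS] at hwS
        have h2 := (Finset.mem_sdiff.1 hx).2
        exact Finset.mem_sdiff.2 ⟨(Finset.mem_union.1 hwS).resolve_left h2, h2⟩
      · exact h
    refine ⟨w, hwS, hmem, fun u' hu' => ?_⟩
    -- Every side to be explored next contains the new vertex `w`, so among the faces seen so far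
    -- only the newest can contain it.
    have hwu : w ∈ (insert w (σ.erase u)).erase u' := by
      refine Finset.mem_erase.2 ⟨?_, Finset.mem_insert_self _ _⟩
      rintro rfl
      exact hwσ (Finset.mem_of_mem_erase hu')
    refine ih (Q := insert (insert w (σ.erase u)) Q) hw (Finset.mem_insert_of_mem hu') ?_ ?_ hX'
      hd' ?_ (by omega) ?_ ?_
    · exact Finset.insert_subset_insert w ((Finset.erase_subset _ _).trans hσS)
    · ext x
      rw [Finset.biUnion_insert, Finset.mem_insert, hS]
      simp only [Finset.mem_union, id, Finset.mem_insert]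
      constructor
      · tauto
      · rintro (h | (h | h) | h)
        · tauto
        · tauto
        · have := hσS (Finset.mem_of_mem_erase h)
          rw [hS, Finset.mem_union] at this
          tauto
        · tauto
    · rw [hcard]
      exact (Finset.card_le_card hcov).trans ((Finset.card_insert_le _ _).trans (by omega))
    · intro q hq hsubq
      rcases Finset.mem_insert.1 hq with rfl | hq
      · rfl
      · refine absurd ?_ hwS
        rw [hS]
        exact Finset.mem_union_right _ (Finset.mem_biUnion.2 ⟨q, hq, hsubq hwu⟩)
    · intro hsubq
      refine absurd ?_ hwS
      rw [hS]
      exact Finset.mem_union_left _ (hsubq hwu)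

/-! ### Counting dense families -/

variable [Fintype V]

open Classical in
/-- The dense families. -/
noncomputable def denseFamilies (d m : ℕ) (S : Finset V) : Finset (Finset (Finset V)) :=
  Finset.univ.filter (IsDense d m S)

/-- The expected number of pairs of a face and a dense family containing it that is present. -/
noncomputable def denseWeight (p : ℝ) (d m : ℕ) (S : Finset V) : ℝ :=
  ∑ Q ∈ denseFamilies d m S, Q.card * p ^ Q.card

/-- A dense family of `q + 1` faces has at most `q` vertices outside `S`. Listing them by a map `g :
Fin q → V` costs the power of `Fintype.card V`; the rest counts sets of subsets of `S` together with
the image of `g`. -/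
lemma card_filter_dense_le (d m : ℕ) (S : Finset V) (q : ℕ) :
    ((denseFamilies d m S).filter fun Q => Q.card = q + 1).card ≤
      Fintype.card V ^ q * 2 ^ 2 ^ (S.card + q) := by
  classical
  have hsub : ((denseFamilies d m S).filter fun Q => Q.card = q + 1) ⊆
      (Finset.univ : Finset (Fin q → V)).biUnion fun g =>
        (S ∪ Finset.univ.image g).powerset.powerset := by
    intro Q hQ
    rw [Finset.mem_filter, denseFamilies, Finset.mem_filter] at hQ
    obtain ⟨⟨-, -, -, h⟩, hq⟩ := hQ
    have hT : (Q.biUnion id \ S).card ≤ q := by omega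
    obtain ⟨g, hg⟩ : ∃ g : Fin q → V, Q.biUnion id \ S ⊆ Finset.univ.image g := by
      rcases (Q.biUnion id \ S).eq_empty_or_nonempty with h0 | ⟨x, hx⟩
      · rcases Nat.eq_zero_or_pos q with rfl | hq0
        · exact ⟨Fin.elim0, by simp [h0]⟩
        · have : Nonempty V := by
            by_contra hV
            rw [not_nonempty_iff] at hV
            have : Q ⊆ {∅} := fun t _ => by
              rw [Finset.mem_singleton]; exact Finset.eq_empty_of_isEmpty t
            have := Finset.card_le_card this
            rw [Finset.card_singleton] at this
            omega
          exact ⟨fun _ => Classical.arbitrary V, by simp [h0]⟩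
      · have e := (Q.biUnion id \ S).equivFin.symm
        -- If there are fewer than `q` vertices, the list is padded with the repeated vertex `x`.
        refine ⟨fun k => if hk : k.1 < (Q.biUnion id \ S).card then (e ⟨k, hk⟩ : V) else x, ?_⟩
        intro y hy
        obtain ⟨k, hk⟩ := e.surjective ⟨y, hy⟩
        refine Finset.mem_image.2 ⟨⟨k, k.2.trans_le hT⟩, Finset.mem_univ _, ?_⟩
        simp [hk]
    refine Finset.mem_biUnion.2 ⟨g, Finset.mem_univ _, ?_⟩
    rw [Finset.mem_powerset]
    intro t ht
    rw [Finset.mem_powerset]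
    intro x hx
    by_cases hxS : x ∈ S
    · exact Finset.mem_union_left _ hxS
    · exact Finset.mem_union_right _
        (hg (Finset.mem_sdiff.2 ⟨Finset.mem_biUnion.2 ⟨t, ht, hx⟩, hxS⟩))
  refine (Finset.card_le_card hsub).trans (Finset.card_biUnion_le.trans ?_)
  have hb : ∀ g ∈ (Finset.univ : Finset (Fin q → V)),
      (S ∪ Finset.univ.image g).powerset.powerset.card ≤ 2 ^ 2 ^ (S.card + q) := by
    intro g _
    rw [Finset.card_powerset, Finset.card_powerset]
    refine Nat.pow_le_pow_right (by norm_num) (Nat.pow_le_pow_right (by norm_num) ?_)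
    refine (Finset.card_union_le _ _).trans (Nat.add_le_add_left ?_ _)
    simpa using Finset.card_image_le (s := (Finset.univ : Finset (Fin q))) (f := g)
  refine (Finset.sum_le_card_nsmul _ _ _ hb).trans ?_
  simp

/-- There are of order n^q families with `q + 1` faces, each of probability (t/n)^(q+1). One factor
1/n remains. -/
lemma denseWeight_le (d m s : ℕ) {t : ℝ} (ht : 0 ≤ t) (S : Finset V) (hS : S.card ≤ s)
    (hV : 0 < Fintype.card V) :
    denseWeight (t / Fintype.card V) d m S ≤
      (∑ q ∈ Finset.range m, (q + 1) * 2 ^ 2 ^ (s + q) * t ^ (q + 1)) / Fintype.card V := by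
  classical
  obtain ⟨n, hn⟩ : ∃ n : ℝ, n = Fintype.card V := ⟨_, rfl⟩
  rw [← hn]
  have hn0 : 0 < n := by rw [hn]; exact_mod_cast hV
  have hmaps : ∀ Q ∈ denseFamilies d m S, Q.card - 1 ∈ Finset.range m := by
    intro Q hQ
    obtain ⟨h1, -, h2⟩ := (Finset.mem_filter.1 hQ).2
    rw [Finset.mem_range]
    omega
  unfold denseWeight
  rw [← Finset.sum_fiberwise_of_maps_to hmaps, Finset.sum_div]
  refine Finset.sum_le_sum fun q _ => ?_
  have hfil : ((denseFamilies d m S).filter fun Q => Q.card - 1 = q) =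
      (denseFamilies d m S).filter fun Q => Q.card = q + 1 := by
    refine Finset.filter_congr fun Q hQ => ?_
    have := (Finset.mem_filter.1 hQ).2.2.2
    omega
  rw [hfil, Finset.sum_congr rfl (g := fun _ => ((q : ℝ) + 1) * (t / n) ^ (q + 1))
    (fun Q hQ => by rw [(Finset.mem_filter.1 hQ).2]; push_cast; rfl), Finset.sum_const,
    nsmul_eq_mul]
  have h1 : (((denseFamilies d m S).filter fun Q => Q.card = q + 1).card : ℝ) ≤
      n ^ q * 2 ^ 2 ^ (s + q) := by
    have h2 := card_filter_dense_le d m S q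
    have h3 : Fintype.card V ^ q * 2 ^ 2 ^ (S.card + q) ≤
        Fintype.card V ^ q * 2 ^ 2 ^ (s + q) :=
      Nat.mul_le_mul_left _ (Nat.pow_le_pow_right (by norm_num)
        (Nat.pow_le_pow_right (by norm_num) (by omega)))
    rw [hn]
    exact_mod_cast h2.trans h3
  calc _ ≤ n ^ q * 2 ^ 2 ^ (s + q) * (((q : ℝ) + 1) * (t / n) ^ (q + 1)) :=
        mul_le_mul_of_nonneg_right h1 (by positivity)
    _ = _ := by
        rw [div_pow, pow_succ n]
        field_simp

end Exploration

/-! ### The probability of staying alive -/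

section Probability

variable {V : Type*} [Fintype V]

/-- All possible faces of dimension `d`. -/
noncomputable def allFaces (V : Type*) [Fintype V] (d : ℕ) : List (Finset V) :=
  (Finset.powersetCard (d + 1) Finset.univ).toList

lemma nodup_allFaces (d : ℕ) : (allFaces V d).Nodup := Finset.nodup_toList _

lemma mem_allFaces {d : ℕ} {s : Finset V} : s ∈ allFaces V d ↔ s.card = d + 1 := by
  simp [allFaces, Finset.mem_powersetCard]

variable [DecidableEq V]

open Classical in
/-- The indicator function of a property. -/
noncomputable def ind {α : Type*} (P : α → Prop) (x : α) : ℝ := if P x then 1 else 0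

lemma ind_of {α : Type*} {P : α → Prop} {x : α} (h : P x) : ind P x = 1 := if_pos h

lemma ind_of_not {α : Type*} {P : α → Prop} {x : α} (h : ¬ P x) : ind P x = 0 := if_neg h

lemma ind_nonneg {α : Type*} (P : α → Prop) (x : α) : 0 ≤ ind P x := by
  unfold ind; split_ifs <;> norm_num

lemma ind_le_one {α : Type*} (P : α → Prop) (x : α) : ind P x ≤ 1 := by
  unfold ind; split_ifs <;> norm_num

lemma ind_mono {α : Type*} {P R : α → Prop} {x y : α} (h : P x → R y) : ind P x ≤ ind R y := by
  by_cases hx : P x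
  · rw [ind_of hx, ind_of (h hx)]
  · rw [ind_of_not hx]; exact ind_nonneg _ _

lemma ind_congr {α : Type*} {P R : α → Prop} {x y : α} (h : P x ↔ R y) : ind P x = ind R y :=
  le_antisymm (ind_mono h.1) (ind_mono h.2)

lemma ind_not {α : Type*} (P : α → Prop) (x : α) : ind (fun x => ¬ P x) x = 1 - ind P x := by
  by_cases hx : P x <;> simp [ind, hx]

lemma ind_and {α : Type*} (P R : α → Prop) (x : α) :
    ind (fun x => P x ∧ R x) x = ind P x * ind R x := by
  by_cases hx : P x <;> by_cases hy : R x <;> simp [ind, hx, hy]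

/-- The probability of `P` for the set of `d`-dimensional faces of the random complex. -/
noncomputable def prob (p : ℝ) (d : ℕ) (P : Finset (Finset V) → Prop) : ℝ :=
  avg p (allFaces V d) (ind P) ∅

variable {p : ℝ} {d m r : ℕ} {τ S σ i : Finset V} {P R : Finset (Finset V) → Prop}

lemma prob_nonneg (h0 : 0 ≤ p) (h1 : p ≤ 1) : 0 ≤ prob p d P :=
  avg_nonneg h0 h1 (ind_nonneg P) _

lemma prob_le_one (h0 : 0 ≤ p) (h1 : p ≤ 1) : prob p d P ≤ 1 :=
  avg_le_of_le h0 h1 (ind_le_one P) _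

lemma prob_not : prob p d (fun X : Finset (Finset V) => ¬ P X) = 1 - prob p d P := by
  unfold prob
  rw [show ind (fun X : Finset (Finset V) => ¬ P X) = fun X : Finset (Finset V) => 1 - ind P X from funext (ind_not P), avg_sub, avg_const]

lemma prob_le_sum (h0 : 0 ≤ p) (h1 : p ≤ 1) {κ : Type*} (s : Finset κ)
    (R : κ → Finset (Finset V) → Prop) (h : ∀ X, P X → ∃ k ∈ s, R k X) :
    prob p d P ≤ ∑ k ∈ s, prob p d (R k) := by
  unfold prob
  rw [← avg_sum]
  refine avg_mono h0 h1 (fun X : Finset (Finset V) => ?_) _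
  by_cases hX : P X
  · obtain ⟨k, hk, hR⟩ := h X hX
    rw [ind_of hX, ← ind_of hR]
    exact Finset.single_le_sum (f := fun k => ind (R k) X) (fun k _ => ind_nonneg _ _) hk
  · rw [ind_of_not hX]
    exact Finset.sum_nonneg fun k _ => ind_nonneg _ _

lemma prob_subset {A : Finset (Finset V)} (hA : ∀ s ∈ A, s.card = d + 1) :
    prob p d (fun X : Finset (Finset V) => A ⊆ X) = p ^ A.card := by
  unfold prob
  rw [← avg_subset (p := p) (nodup_allFaces d) A (fun s hs => mem_allFaces.2 (hA s hs)) ∅]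
  congr 1
  funext X
  by_cases h : A ⊆ X <;> simp [ind, h]

lemma prob_exists_dense_le (h0 : 0 ≤ p) (h1 : p ≤ 1) :
    prob p d (fun X : Finset (Finset V) => ∃ Q ⊆ X, IsDense d m S Q) ≤ denseWeight p d m S := by
  classical
  refine (prob_le_sum h0 h1 (denseFamilies d m S) (fun Q X => Q ⊆ X) ?_).trans ?_
  · rintro X ⟨Q, hQX, hQ⟩
    exact ⟨Q, by simpa [denseFamilies] using hQ, hQX⟩
  · refine Finset.sum_le_sum fun Q hQ => ?_
    have hQ' := (Finset.mem_filter.1 hQ).2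
    rw [prob_subset hQ'.2.1]
    have : (1 : ℝ) ≤ Q.card := by exact_mod_cast (Nat.zero_le _).trans_lt hQ'.2.2
    nlinarith [pow_nonneg h0 Q.card]

/-- A face reached from two sides lies in a dense `Q` whose other members are present. The factor
`p` supplies the missing face, giving `p ^ Q.card`, and summing over `i` counts each `Q` at most
`Q.card` times. This explains the weight in `denseWeight`. -/
lemma sum_reach_le (h0 : 0 ≤ p) (h1 : p ≤ 1) (hσ : σ ⊆ S) (hd : σ.card = d + 1) {U : Finset V}
    (hU : U ⊆ σ) {v : V} (hv : v ∈ σ) (hvU : v ∉ U) :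
    ∑ i ∈ (allFaces V d).toFinset, p * avg p (allFaces V d) (fun X : Finset (Finset V) =>
      ind (fun X : Finset (Finset V) => ∃ u ∈ U, Reach r (σ.erase u) S i (X.erase i)) X *
      ind (fun X : Finset (Finset V) => Reach r (σ.erase v) S i (X.erase i)) X) ∅ ≤ denseWeight p d (2 * r) S := by
  classical
  have key : ∀ i ∈ (allFaces V d).toFinset, p * avg p (allFaces V d) (fun X : Finset (Finset V) =>
      ind (fun X : Finset (Finset V) => ∃ u ∈ U, Reach r (σ.erase u) S i (X.erase i)) X *
      ind (fun X : Finset (Finset V) => Reach r (σ.erase v) S i (X.erase i)) X) ∅ ≤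
      ∑ Q ∈ (denseFamilies d (2 * r) S).filter (fun Q => i ∈ Q), p ^ Q.card := by
    intro i hi
    have e : ∀ X, ind (fun X : Finset (Finset V) => ∃ u ∈ U, Reach r (σ.erase u) S i (X.erase i)) X *
        ind (fun X : Finset (Finset V) => Reach r (σ.erase v) S i (X.erase i)) X =
        ind (fun X : Finset (Finset V) => (∃ u ∈ U, Reach r (σ.erase u) S i (X.erase i)) ∧
          Reach r (σ.erase v) S i (X.erase i)) X := fun X : Finset (Finset V) => (ind_and _ _ X).symm
    simp only [e]
    have h2 := prob_le_sum (d := d) (P := fun X : Finset (Finset V) => (∃ u ∈ U, Reach r (σ.erase u) S i (X.erase i)) ∧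
      Reach r (σ.erase v) S i (X.erase i)) h0 h1
      ((denseFamilies d (2 * r) S).filter (fun Q => i ∈ Q)) (fun Q X => Q.erase i ⊆ X) (by
        rintro X ⟨⟨u, hu, hur⟩, hvr⟩
        obtain ⟨Q, hQ, hiQ, hQX⟩ := exists_dense_of_reach_of_reach hσ hd (hU hu) hv
          (by rintro rfl; exact hvU hu) hur hvr
        exact ⟨Q, by simpa [denseFamilies, hiQ] using hQ, hQX.trans (Finset.erase_subset _ _)⟩)
    refine (mul_le_mul_of_nonneg_left h2 h0).trans ?_
    rw [Finset.mul_sum]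
    refine Finset.sum_le_sum fun Q hQ => ?_
    obtain ⟨hQ, hiQ⟩ := Finset.mem_filter.1 hQ
    have hQ' := (Finset.mem_filter.1 hQ).2
    rw [prob_subset (fun s hs => hQ'.2.1 s (Finset.mem_of_mem_erase hs)), ← pow_succ',
      Finset.card_erase_add_one hiQ]
  refine (Finset.sum_le_sum key).trans ?_
  rw [Finset.sum_comm' (t' := denseFamilies d (2 * r) S)
    (s' := fun Q => (allFaces V d).toFinset.filter fun i => i ∈ Q)
    (by intro i Q; simp only [Finset.mem_filter]; tauto)]
  refine Finset.sum_le_sum fun Q _ => ?_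
  rw [Finset.sum_const, nsmul_eq_mul]
  refine mul_le_mul_of_nonneg_right ?_ (pow_nonneg h0 _)
  exact_mod_cast Finset.card_le_card fun i hi => (Finset.mem_filter.1 hi).2

/-- The explorations from distinct sides of a simplex are nearly independent. -/
lemma prob_forall_alive_le (h0 : 0 ≤ p) (h1 : p ≤ 1) (hσ : σ ⊆ S) (hd : σ.card = d + 1)
    (U : Finset V) (hU : U ⊆ σ) :
    prob p d (fun X : Finset (Finset V) => ∀ u ∈ U, Alive r (σ.erase u) S X) ≤
      ∏ u ∈ U, prob p d (Alive r (σ.erase u) S) + U.card * denseWeight p d (2 * r) S := by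
  induction U using Finset.induction_on with
  | empty => simpa using prob_le_one h0 h1
  | insert v U hvU ih =>
    have hv : v ∈ σ := hU (Finset.mem_insert_self _ _)
    have hU' : U ⊆ σ := (Finset.subset_insert _ _).trans hU
    have ih := ih hU'
    -- A face pivotal for survival is reachable without itself, so reachability in `X.erase i` can
    -- serve as the bound for both marginals.
    have hcov := avg_mul_sub_le (l := allFaces V d) h0 h1 (nodup_allFaces d)
      (f := ind fun X : Finset (Finset V) => ∀ u ∈ U, Alive r (σ.erase u) S X) (g := ind (Alive r (σ.erase v) S))
      (fun X Y hXY => ind_mono fun h u hu => (h u hu).mono hXY)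
      (fun X Y hXY => ind_mono fun h => h.mono hXY)
      (fun i => ind (fun X : Finset (Finset V) => ∃ u ∈ U, Reach r (σ.erase u) S i (X.erase i)))
      (fun i => ind (fun X : Finset (Finset V) => Reach r (σ.erase v) S i (X.erase i)))
      (fun i X Y hXY => ind_mono fun ⟨u, hu, h⟩ =>
        ⟨u, hu, h.mono (Finset.erase_subset_erase i hXY)⟩)
      (fun i X Y hXY => ind_mono fun h => h.mono (Finset.erase_subset_erase i hXY))
      (fun i X => ind_congr (by rw [Finset.erase_insert_eq_erase]))
      (fun i X => ind_congr (by rw [Finset.erase_insert_eq_erase]))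
      (fun i X => by
        unfold marginal
        by_cases ha : ∀ u ∈ U, Alive r (σ.erase u) S (insert i X)
        · by_cases hb : ∀ u ∈ U, Alive r (σ.erase u) S (X.erase i)
          · rw [ind_of ha, ind_of hb, sub_self]; exact ind_nonneg _ _
          · push Not at hb
            obtain ⟨u, hu, hb⟩ := hb
            rw [ind_of (P := fun X : Finset (Finset V) => ∃ u ∈ U, Reach r (σ.erase u) S i (X.erase i))
              ⟨u, hu, reach_of_pivotal (ha u hu) hb⟩]
            linarith [ind_le_one (fun X : Finset (Finset V) => ∀ u ∈ U, Alive r (σ.erase u) S X) (insert i X),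
              ind_nonneg (fun X : Finset (Finset V) => ∀ u ∈ U, Alive r (σ.erase u) S X) (X.erase i)]
        · rw [ind_of_not ha]
          linarith [ind_nonneg (fun X : Finset (Finset V) => ∀ u ∈ U, Alive r (σ.erase u) S X) (X.erase i),
            ind_nonneg (fun X : Finset (Finset V) => ∃ u ∈ U, Reach r (σ.erase u) S i (X.erase i)) X])
      (fun i X => by
        unfold marginal
        by_cases ha : Alive r (σ.erase v) S (insert i X)
        · by_cases hb : Alive r (σ.erase v) S (X.erase i)
          · rw [ind_of ha, ind_of hb, sub_self]; exact ind_nonneg _ _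
          · rw [ind_of (P := fun X : Finset (Finset V) => Reach r (σ.erase v) S i (X.erase i))
              (reach_of_pivotal ha hb)]
            linarith [ind_le_one (Alive r (σ.erase v) S) (insert i X),
              ind_nonneg (Alive r (σ.erase v) S) (X.erase i)]
        · rw [ind_of_not ha]
          linarith [ind_nonneg (Alive r (σ.erase v) S) (X.erase i),
            ind_nonneg (fun X : Finset (Finset V) => Reach r (σ.erase v) S i (X.erase i)) X]) ∅
    have hsum := hcov.trans (sum_reach_le (r := r) h0 h1 hσ hd hU' hv hvU)
    have e : prob p d (fun X : Finset (Finset V) => ∀ u ∈ insert v U, Alive r (σ.erase u) S X) =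
        avg p (allFaces V d) (fun X : Finset (Finset V) => ind (fun X : Finset (Finset V) => ∀ u ∈ U, Alive r (σ.erase u) S X) X *
          ind (Alive r (σ.erase v) S) X) ∅ := by
      unfold prob
      congr 1
      funext X
      rw [← ind_and]
      exact ind_congr (by rw [Finset.forall_mem_insert, and_comm])
    rw [e, Finset.prod_insert hvU, Finset.card_insert_of_notMem hvU]
    have hw : 0 ≤ denseWeight p d (2 * r) S :=
      Finset.sum_nonneg fun Q _ => mul_nonneg (Nat.cast_nonneg _) (pow_nonneg h0 _)
    have a0 := prob_nonneg (d := d) (P := Alive r (σ.erase v) S) h0 h1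
    have a1 := prob_le_one (d := d) (P := Alive r (σ.erase v) S) h0 h1
    have h3 := mul_le_mul_of_nonneg_right ih a0
    have h4 : (U.card : ℝ) * denseWeight p d (2 * r) S * prob p d (Alive r (σ.erase v) S) ≤
        U.card * denseWeight p d (2 * r) S :=
      mul_le_of_le_one_right (mul_nonneg (Nat.cast_nonneg _) hw) a1
    unfold prob at *
    push_cast
    nlinarith

/-- `τ` dies when every `w ∉ S` fails. These failures are decreasing events, so by Harris their
joint probability is at least the product. For a fixed `w` the presence of `insert w τ` is
independent of the exploration behind it, which never queries faces inside `insert w S`. -/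
lemma prob_alive_succ_le (h0 : 0 ≤ p) (h1 : p ≤ 1) (hτ : τ ⊆ S) (hd : τ.card = d) {y : ℝ}
    (hy : ∀ w ∉ S, prob p d (fun X : Finset (Finset V) => ∀ u ∈ τ, Alive r ((insert w τ).erase u) (insert w S) X) ≤ y)
    (hpy : p * y ≤ 1) (hy0 : 0 ≤ y) :
    prob p d (Alive (r + 1) τ S) ≤ 1 - (1 - p * y) ^ Fintype.card V := by
  classical
  let F : V → Finset (Finset V) → ℝ := fun w => ind fun X : Finset (Finset V) => ¬ (insert w τ ∈ X ∧
    ∀ u ∈ τ, Alive r ((insert w τ).erase u) (insert w S) X)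
  have hF : ∀ w, Antitone (F w) := fun w X Y hXY => ind_mono fun h h' =>
    h ⟨hXY h'.1, fun u hu => (h'.2 u hu).mono hXY⟩
  have h2 : 1 - prob p d (Alive (r + 1) τ S) =
      avg p (allFaces V d) (fun X : Finset (Finset V) => ∏ w ∈ Sᶜ, F w X) ∅ := by
    rw [← prob_not]
    unfold prob
    congr 1
    funext X
    by_cases h : Alive (r + 1) τ S X
    · obtain ⟨w, hw, h'⟩ := h
      rw [ind_of_not (P := fun X : Finset (Finset V) => ¬ Alive (r + 1) τ S X)
        (not_not.2 ⟨w, hw, h'⟩)]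
      exact (Finset.prod_eq_zero (i := w) (by simpa using hw) (ind_of_not (not_not.2 h'))).symm
    · rw [ind_of (P := fun X : Finset (Finset V) => ¬ Alive (r + 1) τ S X) h]
      refine (Finset.prod_eq_one fun w hw => ind_of fun h' => h ⟨w, by simpa using hw, h'⟩).symm
  have h3 : ∀ w ∈ Sᶜ, 1 - p * y ≤ avg p (allFaces V d) (F w) ∅ := by
    intro w hw
    have hw : w ∉ S := by simpa using hw
    have hcard : (insert w τ).card = d + 1 := by
      rw [Finset.card_insert_of_notMem (fun h => hw (hτ h)), hd]
    have e1 : avg p (allFaces V d) (F w) ∅ = 1 - prob p d (fun X : Finset (Finset V) => insert w τ ∈ X ∧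
        ∀ u ∈ τ, Alive r ((insert w τ).erase u) (insert w S) X) := prob_not
    have e2 : prob p d (fun X : Finset (Finset V) => insert w τ ∈ X ∧
        ∀ u ∈ τ, Alive r ((insert w τ).erase u) (insert w S) X) =
        p * prob p d (fun X : Finset (Finset V) => ∀ u ∈ τ, Alive r ((insert w τ).erase u) (insert w S) X) := by
      unfold prob
      rw [← avg_ite_mem (nodup_allFaces d) (mem_allFaces.2 hcard)]
      · congr 1
        funext X
        rw [ind_and]
        by_cases h : insert w τ ∈ X <;> simp [ind, h]
      · intro X
        exact ind_congr (forall₂_congr fun u hu =>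
          alive_insert_iff (Finset.insert_subset_insert w hτ))
    rw [e1, e2]
    linarith [mul_le_mul_of_nonneg_left (hy w hw) h0]
  have h4 := prod_avg_le_of_antitone (l := allFaces V d) h0 h1 Sᶜ F (fun w _ => hF w)
    (fun w _ => ind_nonneg _) ∅
  have h5 : (1 - p * y) ^ Fintype.card V ≤ ∏ w ∈ Sᶜ, avg p (allFaces V d) (F w) ∅ := by
    -- Factors for `w ∈ S` are at most 1 and may be added for a lower bound.
    calc (1 - p * y) ^ Fintype.card V ≤ (1 - p * y) ^ (Sᶜ).card :=
          pow_le_pow_of_le_one (by linarith) (by nlinarith) (Finset.card_le_univ _)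
      _ = ∏ w ∈ Sᶜ, (1 - p * y) := by rw [Finset.prod_const]
      _ ≤ _ := Finset.prod_le_prod (fun _ _ => by linarith) h3
  linarith

/-- The probability that a face of the limiting tree survives `r` rounds of collapsing. -/
noncomputable def survival (d : ℕ) (t : ℝ) : ℕ → ℝ
  | 0 => 1
  | r + 1 => 1 - Real.exp (-(t * survival d t r ^ d))

lemma survival_nonneg {t : ℝ} (ht : 0 ≤ t) (d r : ℕ) : 0 ≤ survival d t r := by
  induction r with
  | zero => exact zero_le_one
  | succ r ih =>
    have : 0 ≤ t * survival d t r ^ d := by positivity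
    simpa [survival] using this

/-! ### Survival probabilities as the number of vertices tends to infinity -/

lemma eventually_mul_denseWeight_lt {t : ℝ} (ht : 0 ≤ t) (d m s : ℕ) {ε : ℝ} (hε : 0 < ε) :
    ∀ᶠ n : ℕ in atTop, ∀ S : Finset (Fin n), S.card ≤ s → denseWeight (t / n) d m S < ε := by
  have hlim : Tendsto (fun n : ℕ =>
      (∑ q ∈ Finset.range m, ((q : ℝ) + 1) * 2 ^ 2 ^ (s + q) * t ^ (q + 1)) / (n : ℝ)) atTop (𝓝 0) :=
    tendsto_const_div_atTop_nhds_zero_nat _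
  filter_upwards [hlim.eventually_lt_const hε, eventually_gt_atTop 0] with n hn hn0 S hS
  have := denseWeight_le (V := Fin n) d m s ht S hS (by simpa using hn0)
  rw [Fintype.card_fin] at this
  exact this.trans_lt hn

lemma eventually_div_le {t : ℝ} (ht : 0 ≤ t) {ε : ℝ} (hε : 0 < ε) :
    ∀ᶠ n : ℕ in atTop, 0 ≤ t / n ∧ t / n ≤ ε := by
  filter_upwards [(tendsto_const_div_atTop_nhds_zero_nat t).eventually_lt_const hε] with n hn
  exact ⟨by positivity, hn.le⟩

lemma eventually_forall_alive_le {t : ℝ} (ht : 0 ≤ t) (d r s : ℕ)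
    (h : ∀ ε > 0, ∀ᶠ n : ℕ in atTop, ∀ τ S : Finset (Fin n), τ ⊆ S → τ.card = d → S.card ≤ s →
      prob (t / n) d (Alive r τ S) ≤ survival d t r + ε) {k : ℕ} {ε : ℝ} (hε : 0 < ε) :
    ∀ᶠ n : ℕ in atTop, ∀ σ U S : Finset (Fin n), σ ⊆ S → σ.card = d + 1 → S.card ≤ s → U ⊆ σ →
      U.card = k → prob (t / n) d (fun X : Finset (Finset (Fin n)) => ∀ u ∈ U, Alive r (σ.erase u) S X) ≤
        survival d t r ^ k + ε := by
  have hcont : ContinuousAt (fun η : ℝ => (survival d t r + η) ^ k) 0 := by fun_prop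
  have hlt : ∀ᶠ η in 𝓝[>] (0 : ℝ), (survival d t r + η) ^ k < survival d t r ^ k + ε / 2 :=
    (hcont.eventually_lt_const (by simp [hε])).filter_mono nhdsWithin_le_nhds
  obtain ⟨η, hη, hη0⟩ := (hlt.and self_mem_nhdsWithin).exists
  have hη0 : 0 < η := hη0
  filter_upwards [h η hη0, eventually_div_le ht one_pos, eventually_mul_denseWeight_lt ht d (2 * r) s
    (show 0 < ε / 2 / (k + 1) by positivity)] with n h1 hp hw σ U S hσ hd hS hU hk
  refine (prob_forall_alive_le hp.1 hp.2 hσ hd U hU).trans ?_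
  have h2 : ∏ u ∈ U, prob (t / n) d (Alive r (σ.erase u) S) ≤ (survival d t r + η) ^ k := by
    rw [← hk, ← Finset.prod_const]
    refine Finset.prod_le_prod (fun u _ => prob_nonneg hp.1 hp.2) fun u hu => ?_
    exact h1 _ _ ((Finset.erase_subset _ _).trans hσ)
      (by rw [Finset.card_erase_of_mem (hU hu), hd]; rfl) hS
  have h3 : (U.card : ℝ) * denseWeight (t / n) d (2 * r) S ≤ ε / 2 := by
    have h4 := hw S hS
    rw [lt_div_iff₀ (by positivity)] at h4
    have : 0 ≤ denseWeight (t / n) d (2 * r) S :=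
      Finset.sum_nonneg fun Q _ => mul_nonneg (Nat.cast_nonneg _) (pow_nonneg hp.1 _)
    rw [hk]
    nlinarith
  linarith

/-- Induction on the rounds. The bound `s` on the size of `S` is quantified inside, because each
round enlarges `S` by one vertex. With `y` slightly above `survival d t r ^ d`, the bound 1 - (1 -
ty/n)^n tends to 1 - e^(-ty). -/
lemma eventually_alive_le {t : ℝ} (ht : 0 ≤ t) (d r : ℕ) : ∀ (s : ℕ), ∀ ε > 0,
    ∀ᶠ n : ℕ in atTop, ∀ τ S : Finset (Fin n), τ ⊆ S → τ.card = d → S.card ≤ s →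
      prob (t / n) d (Alive r τ S) ≤ survival d t r + ε := by
  induction r with
  | zero =>
    intro s ε hε
    filter_upwards [eventually_div_le ht one_pos] with n hp τ S _ _ _
    exact (prob_le_one hp.1 hp.2).trans (by simp [survival, hε.le])
  | succ r ih =>
    intro s ε hε
    have hcont : ContinuousAt (fun η : ℝ => 1 - Real.exp (-(t * (survival d t r ^ d + η)))) 0 := by
      fun_prop
    have hlt : ∀ᶠ η in 𝓝[>] (0 : ℝ), 1 - Real.exp (-(t * (survival d t r ^ d + η))) <
        survival d t (r + 1) + ε :=
      (hcont.eventually_lt_const (by simp [survival, hε])).filter_mono nhdsWithin_le_nhds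
    obtain ⟨η, hη, hη0⟩ := (hlt.and self_mem_nhdsWithin).exists
    have hη0 : 0 < η := hη0
    obtain ⟨y, hy⟩ : ∃ y, y = survival d t r ^ d + η := ⟨_, rfl⟩
    rw [← hy] at hη
    have hy0 : 0 ≤ y := by
      have := pow_nonneg (survival_nonneg ht d r) d
      rw [hy]; positivity
    have hlim : Tendsto (fun n : ℕ => 1 - (1 + -(t * y) / n) ^ n) atTop
        (𝓝 (1 - Real.exp (-(t * y)))) :=
      tendsto_const_nhds.sub (Real.tendsto_one_add_div_pow_exp _)
    filter_upwards [eventually_forall_alive_le ht d r (s + 1) (ih (s + 1)) (k := d) hη0,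
      eventually_div_le ht one_pos, eventually_div_le (mul_nonneg ht hy0) one_pos,
      hlim.eventually_lt_const hη] with n h1 hp hpy h2 τ S hτ hd hS
    refine (prob_alive_succ_le hp.1 hp.2 hτ hd (y := y) (fun w hw => ?_) ?_ hy0).trans ?_
    · rw [hy]
      -- Only the `d` sides opposite to the vertices of `τ` are explored; the side opposite to `w`
      -- is `τ` itself.
      refine h1 (insert w τ) τ (insert w S) (Finset.insert_subset_insert w hτ) ?_
        ((Finset.card_insert_le _ _).trans (by omega)) (Finset.subset_insert _ _) hd
      rw [Finset.card_insert_of_notMem (fun h => hw (hτ h)), hd]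
    · rw [div_mul_eq_mul_div]; exact hpy.2
    · rw [Fintype.card_fin]
      refine le_trans (le_of_eq ?_) h2.le
      congr 2
      ring

/-- With probability close to `1 - survival d t r ^ (d + 1)`, some side of a given simplex is
removed in `r` rounds of collapsing and there is no dense family around it. -/
lemma eventually_le_prob_dead {t : ℝ} (ht : 0 ≤ t) (d r : ℕ) {ε : ℝ} (hε : 0 < ε) :
    ∀ᶠ n : ℕ in atTop, ∀ σ : Finset (Fin n), σ.card = d + 1 →
      1 - survival d t r ^ (d + 1) - ε ≤ prob (t / n) d (fun X : Finset (Finset (Fin n)) =>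
        (¬ ∀ u ∈ σ, Alive r (σ.erase u) σ X) ∧ ∀ Q ⊆ X, ¬ IsDense d r σ Q) := by
  filter_upwards [eventually_forall_alive_le ht d r (d + 1)
    (eventually_alive_le ht d r (d + 1)) (k := d + 1) (half_pos hε),
    eventually_div_le ht one_pos, eventually_mul_denseWeight_lt ht d r (d + 1) (half_pos hε)]
    with n h1 hp hw σ hd
  have h2 := h1 σ σ σ subset_rfl hd hd.le subset_rfl hd
  have h3 := (prob_exists_dense_le (d := d) (m := r) (S := σ) hp.1 hp.2).trans (hw σ hd.le).le
  have h4 : prob (t / n) d (fun X : Finset (Finset (Fin n)) => ¬ ((¬ ∀ u ∈ σ, Alive r (σ.erase u) σ X) ∧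
      ∀ Q ⊆ X, ¬ IsDense d r σ Q)) ≤ _ := prob_le_sum hp.1 hp.2 Finset.univ
      (fun b : Bool => if b then (fun X : Finset (Finset (Fin n)) => ∀ u ∈ σ, Alive r (σ.erase u) σ X)
        else (fun X : Finset (Finset (Fin n)) => ∃ Q ⊆ X, IsDense d r σ Q)) (by
      intro X hX
      by_cases h : ∀ u ∈ σ, Alive r (σ.erase u) σ X
      · exact ⟨true, Finset.mem_univ _, by simpa using h⟩
      · refine ⟨false, Finset.mem_univ _, ?_⟩
        by_contra hcon
        exact hX ⟨h, fun Q hQ hQd => hcon (by simpa using ⟨Q, hQ, hQd⟩)⟩)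
  rw [prob_not] at h4
  simp only [Fintype.sum_bool, if_true, Bool.false_eq_true, if_false] at h4
  linarith

end Probability

/-! ### The rank of the boundary operator -/

section Rank

variable (F : Type*) [Field F] {V : Type*} [LinearOrder V]

/-- The boundary of a `d`-dimensional face, and zero for faces of other dimensions. -/
noncomputable def faceBoundary (d : ℕ) (s : Finset V) : Finset V →₀ F :=
  if s.card = d + 1 then simplexBoundary F s else 0

/-- The dimension of the space spanned by the boundaries of the `d`-dimensional members of `X`. -/
noncomputable def boundaryRank (d : ℕ) (X : Finset (Finset V)) : ℕ :=
  Module.finrank F (Submodule.span F (faceBoundary F d '' (X : Set (Finset V))))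

/-- The number of `d`-dimensional members of `X` minus the rank of the boundary operator. -/
noncomputable def nullity (d : ℕ) (X : Finset (Finset V)) : ℝ :=
  (X.filter fun s => s.card = d + 1).card - boundaryRank F d X

lemma finrank_span_insert {K M : Type*} [Field K] [AddCommGroup M] [Module K M] {s : Set M}
    (hs : s.Finite) {x : M} (hx : x ∉ Submodule.span K s) :
    Module.finrank K (Submodule.span K (insert x s)) =
      Module.finrank K (Submodule.span K s) + 1 := by
  have : FiniteDimensional K (Submodule.span K s) := FiniteDimensional.span_of_finite K hs
  have hx0 : x ≠ 0 := by rintro rfl; exact hx (Submodule.zero_mem _)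
  have h := Submodule.finrank_sup_add_finrank_inf_eq (Submodule.span K {x}) (Submodule.span K s)
  have hinf : Submodule.span K {x} ⊓ Submodule.span K s = ⊥ :=
    disjoint_iff.1 ((Submodule.disjoint_span_singleton' hx0).2 hx).symm
  rw [hinf, finrank_bot, finrank_span_singleton hx0] at h
  rw [Submodule.span_insert]
  omega

lemma insert_erase_eq_insert {α : Type*} [DecidableEq α] (X : Finset α) (i : α) :
    insert i (X.erase i) = insert i X := by
  ext j
  by_cases hj : j = i <;> simp [hj]

variable {F} {d : ℕ} {X : Finset (Finset V)} {i : Finset V}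

lemma boundaryRank_insert_of_mem
    (h : faceBoundary F d i ∈ Submodule.span F (faceBoundary F d '' (X.erase i : Set (Finset V)))) :
    boundaryRank F d (insert i X) = boundaryRank F d (X.erase i) := by
  unfold boundaryRank
  rw [← insert_erase_eq_insert X i, Finset.coe_insert, Set.image_insert_eq,
    Submodule.span_insert_eq_span]
  exact_mod_cast h

lemma boundaryRank_insert_of_notMem
    (h : faceBoundary F d i ∉ Submodule.span F (faceBoundary F d '' (X.erase i : Set (Finset V)))) :
    boundaryRank F d (insert i X) = boundaryRank F d (X.erase i) + 1 := by
  unfold boundaryRank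
  rw [← insert_erase_eq_insert X i, Finset.coe_insert, Set.image_insert_eq,
    finrank_span_insert ((Finset.finite_toSet _).image _)]
  exact_mod_cast h

variable (F) in
/-- The boundary of the face `i` is not spanned by the boundaries of the other members of `X`. -/
def EscapesSpan (d : ℕ) (i : Finset V) (X : Finset (Finset V)) : Prop :=
  faceBoundary F d i ∉ Submodule.span F (faceBoundary F d '' (X.erase i : Set (Finset V)))

/-- One additional vector raises the rank by 0 or 1, so the marginal is an indicator. -/
lemma marginal_boundaryRank (i : Finset V) (X : Finset (Finset V)) :
    marginal (fun X => (boundaryRank F d X : ℝ)) i X = ind (EscapesSpan F d i) X := by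
  simp only [marginal]
  by_cases h : EscapesSpan F d i X
  · rw [boundaryRank_insert_of_notMem h, ind_of h]
    push_cast
    ring
  · rw [boundaryRank_insert_of_mem (not_not.1 h), ind_of_not h, sub_self]

/-- Spans grow with the family: this is submodularity of the rank. It allows escape probabilities at
the right end of a parameter interval to bound the growth of the rank across it. -/
lemma antitone_marginal_boundaryRank (i : Finset V) :
    Antitone (marginal (fun X => (boundaryRank F d X : ℝ)) i) := by
  intro X Y h
  rw [marginal_boundaryRank, marginal_boundaryRank]
  refine ind_mono fun hY hX => hY (Submodule.span_mono (Set.image_mono ?_) hX)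
  exact_mod_cast Finset.erase_subset_erase i h

/-- A `d`-face adds 1 to the count and 0 or 1 to the rank. For any other set `faceBoundary` is zero,
which never escapes a span. -/
lemma abs_marginal_nullity_le (i : Finset V) (X : Finset (Finset V)) :
    |marginal (nullity F d) i X| ≤ 1 := by
  have e : marginal (nullity F d) i X =
      (((insert i X).filter fun s => s.card = d + 1).card : ℝ) -
        ((X.erase i).filter fun s => s.card = d + 1).card -
        marginal (fun X => (boundaryRank F d X : ℝ)) i X := by
    unfold marginal nullity; ring
  rw [e, marginal_boundaryRank, ← insert_erase_eq_insert X i, Finset.filter_insert]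
  by_cases hi : i.card = d + 1
  · rw [if_pos hi, Finset.card_insert_of_notMem (by simp), abs_le]
    push_cast
    constructor <;> linarith [ind_nonneg (EscapesSpan F d i) X, ind_le_one (EscapesSpan F d i) X]
  · rw [if_neg hi, ind_of_not]
    · simp
    · simp [EscapesSpan, faceBoundary, hi]

lemma simplexBoundary_apply_erase {s : Finset V} (hs : 1 < s.card) {u : V} (hu : u ∈ s) :
    simplexBoundary F s (s.erase u) ≠ 0 := by
  rw [simplexBoundary, if_neg (by omega), Finsupp.finsetSum_apply,
    Finset.sum_eq_single_of_mem u hu]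
  · simp
  · intro v hv hvu
    rw [Finsupp.single_apply, if_neg]
    intro h
    have : u ∈ s.erase v := Finset.mem_erase.2 ⟨hvu.symm, hu⟩
    rw [h] at this
    simp at this

lemma exists_of_simplexBoundary_apply_ne_zero {s t : Finset V} (h : simplexBoundary F s t ≠ 0) :
    ∃ v ∈ s, s.erase v = t := by
  by_contra hcon
  push Not at hcon
  refine h ?_
  unfold simplexBoundary
  split_ifs
  · rfl
  · rw [Finsupp.finsetSum_apply]
    exact Finset.sum_eq_zero fun v hv => by rw [Finsupp.single_apply, if_neg (hcon v hv)]

lemma faceBoundary_mem_supported (s : Finset V) :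
    faceBoundary F d s ∈ Finsupp.supported F F {t : Finset V | t.card = d} := by
  rw [Finsupp.mem_supported]
  intro t ht
  rw [Finset.mem_coe, Finsupp.mem_support_iff, faceBoundary] at ht
  split_ifs at ht with hs
  · obtain ⟨v, hv, rfl⟩ := exists_of_simplexBoundary_apply_ne_zero ht
    simp [Finset.card_erase_of_mem hv, hs]
  · exact absurd rfl ht

/-- All boundaries lie in the space with basis the `d`-sets of vertices. This cap anchors the
downward integration of the rank. -/
lemma boundaryRank_le [Fintype V] : boundaryRank F d X ≤ (Fintype.card V).choose d := by
  have h1 : Submodule.span F (faceBoundary F d '' (X : Set (Finset V))) ≤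
      Finsupp.supported F F {t : Finset V | t.card = d} := by
    rw [Submodule.span_le]
    rintro _ ⟨s, -, rfl⟩
    exact faceBoundary_mem_supported s
  have h2 : Module.finrank F (Finsupp.supported F F {t : Finset V | t.card = d}) =
      (Fintype.card V).choose d := by
    rw [LinearEquiv.finrank_eq (Finsupp.supportedEquivFinsupp _), Module.finrank_finsupp_self,
      ← Fintype.card_finset_len]
    rfl
  rw [← h2]
  exact Submodule.finrank_mono h1

/-- A simplex with a removable side is not a boundary combination of the other faces. -/
lemma escapesSpan_of_dead {r : ℕ} {σ : Finset V} (hd : 1 ≤ d) (hσ : σ.card = d + 1)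
    (h1 : ¬ ∀ u ∈ σ, Alive r (σ.erase u) σ X) (h2 : ∀ Q ⊆ X, ¬ IsDense d r σ Q) :
    EscapesSpan F d σ X := by
  intro hmem
  rw [Finsupp.mem_span_image_iff_linearCombination] at hmem
  obtain ⟨z, hz, hzσ⟩ := hmem
  -- The relation becomes a cycle `c` with `σ` in its support. Its support plays the role of the
  -- family without free faces in `alive_of_core`.
  obtain ⟨c, hc⟩ : ∃ c, c = z - Finsupp.single σ 1 := ⟨_, rfl⟩
  have hc0 : Finsupp.linearCombination F (faceBoundary F d) c = 0 := by
    rw [hc, map_sub, hzσ, Finsupp.linearCombination_single, one_smul, sub_self]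
  have hzσ0 : z σ = 0 := by
    by_contra hne
    have := hz (Finsupp.mem_support_iff.2 hne)
    simp at this
  have hcσ : c σ ≠ 0 := by rw [hc]; simp [hzσ0]
  refine h1 fun u hu => ?_
  refine alive_of_core (m := r) (Q := ∅) (Z := {s | c s ≠ 0 ∧ s.card = d + 1}) ?_ ?_
    (fun s hs => hs.2) h2 ⟨hcσ, hσ⟩ hu subset_rfl (by simp) (by simp) (by simp) (by simp) (by simp)
    (by simp) (fun _ => rfl)
  -- If `s` were the only supporting face containing `s.erase v`, the coefficient there would be
  -- that of `s` up to sign and could not cancel.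
  · rintro s ⟨hs, hsd⟩ v hv
    by_contra hcon
    push Not at hcon
    have h3 := DFunLike.congr_fun hc0 (s.erase v)
    rw [Finsupp.linearCombination_apply, Finsupp.sum, Finsupp.finsetSum_apply,
      Finset.sum_eq_single_of_mem s (Finsupp.mem_support_iff.2 hs)] at h3
    · rw [faceBoundary, if_pos hsd, Finsupp.smul_apply, smul_eq_mul, Finsupp.zero_apply] at h3
      exact (mul_ne_zero hs (simplexBoundary_apply_erase (by omega) hv)) h3
    · intro t ht hts
      rw [Finsupp.smul_apply, smul_eq_mul]
      by_contra hne
      have h4 := right_ne_zero_of_mul hne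
      rw [faceBoundary] at h4
      split_ifs at h4 with htd
      · obtain ⟨w, hw, hws⟩ := exists_of_simplexBoundary_apply_ne_zero h4
        have htw : insert w (s.erase v) = t := by rw [← hws, Finset.insert_erase hw]
        have hws' : w ∉ s := by
          intro h
          by_cases hwv : w = v
          · subst hwv
            rw [Finset.insert_erase hv] at htw
            exact hts htw.symm
          · have : w ∈ s.erase v := Finset.mem_erase.2 ⟨hwv, h⟩
            rw [← hws] at this
            simp at this
        refine hcon w hws' ?_
        rw [htw]
        exact ⟨Finsupp.mem_support_iff.1 ht, htd⟩
      · exact h4 rfl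
  · rintro s ⟨hs, -⟩
    by_cases hsσ : s = σ
    · exact Or.inl hsσ
    · right
      rw [hc, Finsupp.sub_apply, Finsupp.single_apply, if_neg (Ne.symm hsσ), sub_zero] at hs
      exact Finset.mem_of_mem_erase (hz (Finsupp.mem_support_iff.2 hs))

end Rank

/-- Positive nullity of the boundary operator means nonzero top homology. -/
lemma nontrivial_homology_of_nullity_pos {F : Type*} [Field F] {n d : ℕ} (hd : 1 ≤ d)
    {X : Finset (Finset (Fin n))} (h : 0 < nullity F d X) :
    Nontrivial (Homology F (complexOfFaces n d (X : Set (Finset (Fin n)))) d) := by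
  refine Submodule.Quotient.nontrivial_iff.2 fun htop => ?_
  -- There are no faces of dimension `d + 1`, so top homology is just the space of cycles.
  have hB : boundaries F (complexOfFaces n d (X : Set (Finset (Fin n)))) d = ⊥ := by
    have : chains F (complexOfFaces n d (X : Set (Finset (Fin n)))) (d + 1) = ⊥ := by
      have : {s | s ∈ complexOfFaces n d (X : Set (Finset (Fin n))) ∧ s.card = d + 1 + 1} = ∅ := by
        ext s
        simp only [Set.mem_ofPred_eq, Set.mem_empty_iff_false, iff_false, not_and]
        rintro ⟨-, hs⟩
        omega
      rw [chains, this, Finsupp.supported_empty]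
    rw [boundaries, this, Submodule.map_bot]
  have hker : ∀ c ∈ cycles F (complexOfFaces n d (X : Set (Finset (Fin n)))) d, c = 0 := by
    intro c hc
    have h1 : (⟨c, hc⟩ : cycles F (complexOfFaces n d (X : Set (Finset (Fin n)))) d) ∈
        (boundaries F (complexOfFaces n d (X : Set (Finset (Fin n)))) d).submoduleOf
          (cycles F (complexOfFaces n d (X : Set (Finset (Fin n)))) d) := by
      rw [htop]; trivial
    rw [Submodule.submoduleOf, Submodule.mem_comap, hB] at h1
    exact (Submodule.mem_bot F).1 h1
  -- Without nonzero cycles the boundaries of the `d`-faces are independent, and the rank is at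
  -- least their number.
  have hind : LinearIndepOn F (simplexBoundary F)
      ((X.filter fun s => s.card = d + 1 : Finset (Finset (Fin n))) : Set (Finset (Fin n))) := by
    rw [linearIndepOn_iff]
    intro c hc hc0
    refine hker c ⟨?_, hc0⟩
    refine Finsupp.supported_mono ?_ hc
    intro s hs
    obtain ⟨hsX, hsd⟩ := Finset.mem_filter.1 (Finset.mem_coe.1 hs)
    refine ⟨⟨?_, Or.inr ⟨hsd, hsX⟩⟩, hsd⟩
    rw [← Finset.card_pos]
    omega
  have hle : (X.filter fun s => s.card = d + 1).card ≤ boundaryRank F d X := by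
    have h1 := finrank_span_eq_card hind
    rw [← Set.toFinset_card, Finset.toFinset_coe] at h1
    rw [← h1]
    have : FiniteDimensional F (Submodule.span F (faceBoundary F d '' (X : Set (Finset (Fin n))))) :=
      FiniteDimensional.span_of_finite F ((Finset.finite_toSet _).image _)
    refine Submodule.finrank_mono (Submodule.span_mono ?_)
    rintro _ ⟨⟨s, hs⟩, rfl⟩
    obtain ⟨hsX, hsd⟩ := Finset.mem_filter.1 (Finset.mem_coe.1 hs)
    exact ⟨s, hsX, if_pos hsd⟩
  have : ((X.filter fun s => s.card = d + 1).card : ℝ) ≤ boundaryRank F d X := by exact_mod_cast hle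
  unfold nullity at h
  linarith

/-! ### The critical root -/

section Root

/-- The equation for the critical root, cleared of denominators. -/
noncomputable def rootFun (d : ℕ) (b : ℝ) : ℝ :=
  -Real.log (1 - b) * (d + 1 - d * b) - (d + 1) * b

/-- The derivative of `rootFun`. -/
noncomputable def rootSlope (d : ℕ) (b : ℝ) : ℝ := b / (1 - b) + d * Real.log (1 - b)

variable {d : ℕ} {b : ℝ}

/-! ### Existence and uniqueness of the critical root -/

lemma isCriticalRoot_iff : IsCriticalRoot d b ↔ (0 < b ∧ b < 1) ∧ rootFun d b = 0 := by
  unfold IsCriticalRoot rootFun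
  refine and_congr_right fun ⟨h0, h1⟩ => ?_
  have hpos : (0 : ℝ) < d + 1 - d * b := by nlinarith [Nat.cast_nonneg (α := ℝ) d]
  rw [eq_div_iff hpos.ne', sub_eq_zero]

lemma hasDerivAt_log_one_sub (hb : b < 1) :
    HasDerivAt (fun x : ℝ => Real.log (1 - x)) (-(1 / (1 - b))) b := by
  have h := ((hasDerivAt_const b (1 : ℝ)).sub (hasDerivAt_id b)).log
    (show (1 : ℝ) - b ≠ 0 by linarith)
  refine h.congr_deriv ?_
  simp only [Pi.sub_apply, id]
  ring

lemma hasDerivAt_rootFun (hb : b < 1) : HasDerivAt (rootFun d) (rootSlope d b) b := by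
  have h1 : (1 : ℝ) - b ≠ 0 := by linarith
  have h := ((hasDerivAt_log_one_sub hb).neg.mul
    ((hasDerivAt_const b ((d : ℝ) + 1)).sub ((hasDerivAt_id b).const_mul (d : ℝ)))).sub
    ((hasDerivAt_id b).const_mul ((d : ℝ) + 1))
  refine HasDerivAt.congr_deriv (f := rootFun d) h ?_
  simp only [rootSlope, id, Pi.sub_apply, Pi.neg_apply]
  field_simp
  ring

lemma hasDerivAt_rootSlope (hb : b < 1) :
    HasDerivAt (rootSlope d) ((1 - d * (1 - b)) / (1 - b) ^ 2) b := by
  have h1 : (1 : ℝ) - b ≠ 0 := by linarith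
  have h := ((hasDerivAt_id b).div ((hasDerivAt_const b (1 : ℝ)).sub (hasDerivAt_id b)) h1).add
    ((hasDerivAt_log_one_sub hb).const_mul (d : ℝ))
  refine HasDerivAt.congr_deriv (f := rootSlope d) h ?_
  simp only [id, Pi.sub_apply]
  field_simp
  ring

lemma continuousOn_rootFun {s : Set ℝ} (hs : ∀ x ∈ s, x < 1) : ContinuousOn (rootFun d) s :=
  fun x hx => (hasDerivAt_rootFun (hs x hx)).continuousAt.continuousWithinAt

lemma continuousOn_rootSlope {s : Set ℝ} (hs : ∀ x ∈ s, x < 1) : ContinuousOn (rootSlope d) s :=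
  fun x hx => (hasDerivAt_rootSlope (hs x hx)).continuousAt.continuousWithinAt

lemma one_sub_inv_mem (hd : 2 ≤ d) : (0 : ℝ) < 1 - 1 / d ∧ (1 : ℝ) - 1 / d < 1 := by
  have hd' : (2 : ℝ) ≤ d := by exact_mod_cast hd
  have : (1 : ℝ) / d ≤ 1 / 2 := one_div_le_one_div_of_le (by norm_num) hd'
  have : (0 : ℝ) < 1 / d := by positivity
  constructor <;> linarith

/-- The slope vanishes at 0, and its derivative is negative up to the turning point 1 - 1/d. -/
lemma rootSlope_neg (hd : 2 ≤ d) (h0 : 0 < b) (hb : b ≤ 1 - 1 / d) : rootSlope d b < 0 := by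
  have hd0 : (0 : ℝ) < d := by exact_mod_cast (by omega : 0 < d)
  have ha := one_sub_inv_mem hd
  have hanti : StrictAntiOn (rootSlope d) (Set.Icc 0 (1 - 1 / (d : ℝ))) := by
    refine strictAntiOn_of_deriv_neg (convex_Icc _ _)
      (continuousOn_rootSlope fun x hx => hx.2.trans_lt ha.2) fun x hx => ?_
    rw [interior_Icc] at hx
    rw [(hasDerivAt_rootSlope (hx.2.trans ha.2)).deriv]
    have h1 : (1 : ℝ) / d < 1 - x := by linarith [hx.2]
    rw [div_lt_iff₀ hd0] at h1
    exact div_neg_of_neg_of_pos (by linarith) (pow_pos (by linarith [hx.2, ha.2]) 2)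
  have := hanti ⟨le_rfl, ha.1.le⟩ ⟨h0.le, hb⟩ h0
  simpa [rootSlope] using this

lemma strictMonoOn_rootSlope (hd : 2 ≤ d) :
    StrictMonoOn (rootSlope d) (Set.Ico (1 - 1 / (d : ℝ)) 1) := by
  have hd0 : (0 : ℝ) < d := by exact_mod_cast (by omega : 0 < d)
  refine strictMonoOn_of_deriv_pos (convex_Ico _ _)
    (continuousOn_rootSlope fun x hx => hx.2) fun x hx => ?_
  rw [interior_Ico] at hx
  rw [(hasDerivAt_rootSlope hx.2).deriv]
  have h1 : 1 - x < (1 : ℝ) / d := by linarith [hx.1]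
  rw [lt_div_iff₀ hd0] at h1
  exact div_pos (by linarith) (pow_pos (by linarith [hx.2]) 2)

lemma rootFun_neg (hd : 2 ≤ d) (h0 : 0 < b) (hb : b ≤ 1 - 1 / d) : rootFun d b < 0 := by
  have ha := one_sub_inv_mem hd
  have hanti : StrictAntiOn (rootFun d) (Set.Icc 0 (1 - 1 / (d : ℝ))) := by
    refine strictAntiOn_of_deriv_neg (convex_Icc _ _)
      (continuousOn_rootFun fun x hx => hx.2.trans_lt ha.2) fun x hx => ?_
    rw [interior_Icc] at hx
    rw [(hasDerivAt_rootFun (hx.2.trans ha.2)).deriv]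
    exact rootSlope_neg hd hx.1 hx.2.le
  have := hanti ⟨le_rfl, ha.1.le⟩ ⟨h0.le, hb⟩ h0
  simpa [rootFun] using this

lemma IsCriticalRoot.lt (hd : 2 ≤ d) (h : IsCriticalRoot d b) : 1 - 1 / (d : ℝ) < b := by
  rw [isCriticalRoot_iff] at h
  by_contra hcon
  exact (rootFun_neg hd h.1.1 (not_lt.1 hcon)).ne h.2

/-- `rootFun` is negative at 1 - 1/d and zero at the root, so by the mean value theorem its slope is
positive somewhere between. Beyond 1 - 1/d the slope increases. -/
lemma IsCriticalRoot.rootSlope_pos (hd : 2 ≤ d) (h : IsCriticalRoot d b) {x : ℝ} (hx : b ≤ x)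
    (hx1 : x < 1) : 0 < rootSlope d x := by
  have ha := one_sub_inv_mem hd
  have hab := h.lt hd
  obtain ⟨⟨h0, h1⟩, hr⟩ := isCriticalRoot_iff.1 h
  obtain ⟨y, hy, hy'⟩ := exists_hasDerivAt_eq_slope (rootFun d) (rootSlope d) hab
    (continuousOn_rootFun fun x hx => hx.2.trans_lt h1)
    fun x hx => hasDerivAt_rootFun (hx.2.trans h1)
  have hpos : 0 < rootSlope d y := by
    rw [hy', hr]
    exact div_pos (by linarith [rootFun_neg hd ha.1 le_rfl]) (by linarith)
  exact hpos.trans (strictMonoOn_rootSlope hd ⟨hy.1.le, hy.2.trans h1⟩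
    ⟨hab.le.trans hx, hx1⟩ (hy.2.trans_le hx))

lemma IsCriticalRoot.rootFun_pos (hd : 2 ≤ d) (h : IsCriticalRoot d b) {x : ℝ} (hx : b < x)
    (hx1 : x < 1) : 0 < rootFun d x := by
  obtain ⟨⟨h0, h1⟩, hr⟩ := isCriticalRoot_iff.1 h
  have hmono : StrictMonoOn (rootFun d) (Set.Ico b 1) := by
    refine strictMonoOn_of_deriv_pos (convex_Ico _ _)
      (continuousOn_rootFun fun x hx => hx.2) fun y hy => ?_
    rw [interior_Ico] at hy
    rw [(hasDerivAt_rootFun hy.2).deriv]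
    exact h.rootSlope_pos hd hy.1.le hy.2
  rw [← hr]
  exact hmono ⟨le_rfl, h1⟩ ⟨hx.le, hx1⟩ hx

lemma IsCriticalRoot.unique (hd : 2 ≤ d) {b' : ℝ} (h : IsCriticalRoot d b)
    (h' : IsCriticalRoot d b') : b = b' := by
  rcases lt_trichotomy b b' with hlt | rfl | hlt
  · exact absurd (isCriticalRoot_iff.1 h').2 (h.rootFun_pos hd hlt h'.1.2).ne'
  · rfl
  · exact absurd (isCriticalRoot_iff.1 h).2 (h'.rootFun_pos hd hlt h.1.2).ne'

lemma exists_isCriticalRoot_between {x y : ℝ} (hx : 0 < x) (hxy : x < y) (hy : y < 1)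
    (hfx : rootFun d x < 0) (hfy : 0 < rootFun d y) : ∃ b, IsCriticalRoot d b ∧ x < b ∧ b < y := by
  obtain ⟨b, hb, hb0⟩ := intermediate_value_Ioo hxy.le
    (continuousOn_rootFun (d := d) fun z hz => hz.2.trans_lt hy) (Set.mem_Ioo.2 ⟨hfx, hfy⟩)
  exact ⟨b, isCriticalRoot_iff.2 ⟨⟨hx.trans hb.1, hb.2.trans hy⟩, hb0⟩, hb⟩

lemma exists_isCriticalRoot (hd : 2 ≤ d) : ∃ b, IsCriticalRoot d b := by
  have ha := one_sub_inv_mem hd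
  have hd0 : (0 : ℝ) < d := by exact_mod_cast (by omega : 0 < d)
  have he : Real.exp (-((d : ℝ) + 2)) < 1 / d := by
    rw [Real.exp_neg, ← one_div]
    refine one_div_lt_one_div_of_lt hd0 ?_
    linarith [Real.add_one_le_exp ((d : ℝ) + 2)]
  have he0 := Real.exp_pos (-((d : ℝ) + 2))
  -- At 1 - e^(-(d+2)) the logarithm equals -(d+2), which makes `rootFun` positive.
  obtain ⟨b, hb, -⟩ := exists_isCriticalRoot_between (d := d) (x := 1 - 1 / d)
    (y := 1 - Real.exp (-((d : ℝ) + 2))) ha.1 (by linarith) (by linarith)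
    (rootFun_neg hd ha.1 le_rfl) (by
      rw [rootFun, sub_sub_cancel, Real.log_exp]
      nlinarith [mul_pos hd0 he0, mul_pos hd0 (mul_pos hd0 he0)])
  exact ⟨b, hb⟩

/-! ### The critical value as a function of the root -/

/-- The factor `rootSlope` is shared with the derivative of `rootFun`, so beyond the root both
functions increase. -/
lemma hasDerivAt_criticalValue (h0 : 0 < b) (hb : b < 1) :
    HasDerivAt (criticalValue d) (rootSlope d b / b ^ (d + 1)) b := by
  have h1 : (1 : ℝ) - b ≠ 0 := by linarith
  have h := (hasDerivAt_log_one_sub hb).neg.div (hasDerivAt_pow d b) (pow_ne_zero d h0.ne')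
  refine HasDerivAt.congr_deriv (f := criticalValue d) h ?_
  simp only [rootSlope, Pi.neg_apply]
  rcases d with _ | d
  · simp; field_simp
  · rw [Nat.add_sub_cancel]
    field_simp
    ring

lemma continuousOn_criticalValue {s : Set ℝ} (hs : ∀ x ∈ s, 0 < x ∧ x < 1) :
    ContinuousOn (criticalValue d) s :=
  fun x hx => (hasDerivAt_criticalValue (hs x hx).1 (hs x hx).2).continuousAt.continuousWithinAt

lemma IsCriticalRoot.strictMonoOn_criticalValue (hd : 2 ≤ d) (h : IsCriticalRoot d b) :
    StrictMonoOn (criticalValue d) (Set.Ico b 1) := by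
  refine strictMonoOn_of_deriv_pos (convex_Ico _ _)
    (continuousOn_criticalValue fun x hx => ⟨h.1.1.trans_le hx.1, hx.2⟩) fun x hx => ?_
  rw [interior_Ico] at hx
  have h0 := h.1.1.trans hx.1
  rw [(hasDerivAt_criticalValue h0 hx.2).deriv]
  exact div_pos (h.rootSlope_pos hd hx.1.le hx.2) (pow_pos h0 _)

lemma criticalValue_pos (h0 : 0 < b) (hb : b < 1) : 0 < criticalValue d b :=
  div_pos (neg_pos.2 (Real.log_neg (by linarith) (by linarith))) (pow_pos h0 _)

/-- The critical value is at least -ln(1 - x) and so unbounded near 1. The parameter `c` can thus be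
replaced by the coordinate `q`. -/
lemma IsCriticalRoot.exists_criticalValue_eq (h : IsCriticalRoot d b) {c : ℝ}
    (hc : criticalValue d b < c) : ∃ q, b < q ∧ q < 1 ∧ criticalValue d q = c := by
  obtain ⟨h0, h1⟩ := h.1
  have hlim : Tendsto (fun x : ℝ => -Real.log (1 - x)) (𝓝[<] 1) atTop := by
    refine tendsto_neg_atBot_atTop.comp (Real.tendsto_log_nhdsGT_zero.comp ?_)
    refine tendsto_nhdsWithin_iff.2 ⟨?_, ?_⟩
    · have : Tendsto (fun x : ℝ => 1 - x) (𝓝 1) (𝓝 (1 - 1)) :=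
        tendsto_const_nhds.sub tendsto_id
      rw [sub_self] at this
      exact this.mono_left nhdsWithin_le_nhds
    · filter_upwards [self_mem_nhdsWithin] with x hx
      exact sub_pos.2 (Set.mem_Iio.1 hx)
  have hev : ∀ᶠ x in 𝓝[<] (1 : ℝ), b < x := (eventually_gt_nhds h1).filter_mono nhdsWithin_le_nhds
  obtain ⟨y, ⟨hcy, hby⟩, hy1⟩ :=
    (((hlim.eventually_gt_atTop c).and hev).and self_mem_nhdsWithin).exists
  have hy1 : y < 1 := hy1
  have hy : c < criticalValue d y := by
    refine hcy.trans_le ?_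
    have : 0 < -Real.log (1 - y) := neg_pos.2 (Real.log_neg (by linarith) (by linarith))
    rw [criticalValue, le_div_iff₀ (pow_pos (h0.trans hby) _)]
    exact mul_le_of_le_one_right this.le (pow_le_one₀ (h0.trans hby).le hy1.le)
  obtain ⟨q, hq, hqc⟩ := intermediate_value_Ioo hby.le
    (continuousOn_criticalValue (d := d) fun z hz => ⟨h0.trans_le hz.1, hz.2.trans_lt hy1⟩)
    (Set.mem_Ioo.2 ⟨hc, hy⟩)
  exact ⟨q, hq.1, hq.2.trans hy1, hqc⟩

/-- The survival probabilities decrease to at most the point where the critical value is `t`. -/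
lemma IsCriticalRoot.exists_survival_pow_le (hd : 2 ≤ d) (h : IsCriticalRoot d b) {q : ℝ}
    (hq : b ≤ q) (hq1 : q < 1) {ε : ℝ} (hε : 0 < ε) :
    ∃ r, survival d (criticalValue d q) r ^ (d + 1) ≤ q ^ (d + 1) + ε := by
  have hq0 : 0 < q := h.1.1.trans_le hq
  obtain ⟨t, ht⟩ : ∃ t, t = criticalValue d q := ⟨_, rfl⟩
  have ht0 : 0 < t := ht ▸ criticalValue_pos hq0 hq1
  rw [← ht]
  -- The recursion is increasing in its argument and starts at the upper bound 1.
  have hanti : Antitone (survival d t) := by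
    refine antitone_nat_of_succ_le fun r => ?_
    induction r with
    | zero => simp [survival, Real.exp_nonneg]
    | succ r ih =>
      have h1 := pow_le_pow_left₀ (survival_nonneg ht0.le d (r + 1)) ih d
      have h2 := mul_le_mul_of_nonneg_left h1 ht0.le
      exact sub_le_sub_left (Real.exp_le_exp.2 (neg_le_neg h2)) _
  have hbdd : BddBelow (Set.range (survival d t)) :=
    ⟨0, by rintro _ ⟨r, rfl⟩; exact survival_nonneg ht0.le d r⟩
  obtain ⟨L, hL⟩ : ∃ L, Tendsto (survival d t) atTop (𝓝 L) :=
    ⟨_, tendsto_atTop_ciInf hanti hbdd⟩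
  have hL0 : 0 ≤ L := ge_of_tendsto' hL fun r => survival_nonneg ht0.le d r
  have hfix : L = 1 - Real.exp (-(t * L ^ d)) := by
    have h1 := hL.comp (tendsto_add_atTop_nat 1)
    have h2 : Tendsto (fun r => 1 - Real.exp (-(t * survival d t r ^ d))) atTop
        (𝓝 (1 - Real.exp (-(t * L ^ d)))) := by
      have hc : Continuous fun x : ℝ => 1 - Real.exp (-(t * x ^ d)) := by fun_prop
      exact (hc.tendsto L).comp hL
    exact tendsto_nhds_unique h1 h2
  -- A positive fixed point `L < 1` satisfies `criticalValue d L = t`; above the root this value is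
  -- taken only at `q`.
  have hLq : L ≤ q := by
    by_contra hcon
    have hcon := not_le.1 hcon
    have hL1 : L < 1 := by linarith [Real.exp_pos (-(t * L ^ d))]
    have hlog : -Real.log (1 - L) = t * L ^ d := by
      rw [show 1 - L = Real.exp (-(t * L ^ d)) by linarith, Real.log_exp, neg_neg]
    have hLt : criticalValue d L = t := by
      rw [criticalValue, hlog, mul_div_cancel_right₀ _ (pow_ne_zero d (hq0.trans hcon).ne')]
    have := h.strictMonoOn_criticalValue hd ⟨hq, hq1⟩ ⟨hq.trans hcon.le, hL1⟩ hcon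
    linarith
  have h3 := (hL.pow (d + 1)).eventually_lt_const
    (show L ^ (d + 1) < q ^ (d + 1) + ε by linarith [pow_le_pow_left₀ hL0 hLq (d + 1)])
  obtain ⟨r, hr⟩ := h3.exists
  exact ⟨r, hr.le⟩

/-- The limiting density of the rank, up to an additive constant, in terms of the survival
probability. -/
noncomputable def rankDensity (d : ℕ) (q : ℝ) : ℝ :=
  criticalValue d q * (1 - q ^ (d + 1)) / (d + 1) + (1 - q) * Real.log (1 - q) + q

/-- As a function of t = `criticalValue d q`, `rankDensity` is an antiderivative of (1 -
q^(d+1))/(d+1). The summands (1 - q) ln(1 - q) + q cancel the contribution of the derivative of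
q^(d+1). -/
lemma hasDerivAt_rankDensity (h0 : 0 < b) (hb : b < 1) : HasDerivAt (rankDensity d)
    (rootSlope d b / b ^ (d + 1) * ((1 - b ^ (d + 1)) / (d + 1))) b := by
  have h1 : (1 : ℝ) - b ≠ 0 := by linarith
  have h := ((((hasDerivAt_criticalValue (d := d) h0 hb).mul
    ((hasDerivAt_const b (1 : ℝ)).sub (hasDerivAt_pow (d + 1) b))).div_const ((d : ℝ) + 1)).add
    (((hasDerivAt_const b (1 : ℝ)).sub (hasDerivAt_id b)).mul (hasDerivAt_log_one_sub hb))).add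
    (hasDerivAt_id b)
  refine HasDerivAt.congr_deriv (f := rankDensity d) h ?_
  have h2 : criticalValue d b * b ^ d = -Real.log (1 - b) := by
    rw [criticalValue, div_mul_cancel₀ _ (pow_ne_zero d h0.ne')]
  have h3 : ((d : ℝ) + 1) ≠ 0 := by positivity
  simp only [Pi.sub_apply, id, Nat.add_sub_cancel]
  push_cast
  have e1 : criticalValue d b * (0 - ((d : ℝ) + 1) * b ^ d) / (d + 1) = Real.log (1 - b) := by
    rw [show criticalValue d b * (0 - ((d : ℝ) + 1) * b ^ d) =
      -(criticalValue d b * b ^ d) * (d + 1) by ring, h2, neg_neg, mul_div_cancel_right₀ _ h3]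
  rw [add_div, e1, mul_neg, mul_one_div_cancel h1]
  ring

/-- The integrand (1 - z^(d+1))/(d+1) decreases, so its value at the left end is an upper bound. -/
lemma IsCriticalRoot.rankDensity_sub_le (hd : 2 ≤ d) (h : IsCriticalRoot d b) {x y : ℝ}
    (hx : b ≤ x) (hxy : x ≤ y) (hy : y < 1) :
    rankDensity d y - rankDensity d x ≤
      (criticalValue d y - criticalValue d x) * ((1 - x ^ (d + 1)) / (d + 1)) := by
  obtain ⟨K, hK⟩ : ∃ K, K = (1 - x ^ (d + 1)) / ((d : ℝ) + 1) := ⟨_, rfl⟩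
  have hx0 := h.1.1.trans_le hx
  have hder : ∀ z ∈ Set.Icc x y, HasDerivAt (fun z => rankDensity d z - K * criticalValue d z)
      (rootSlope d z / z ^ (d + 1) * ((1 - z ^ (d + 1)) / (d + 1)) -
        K * (rootSlope d z / z ^ (d + 1))) z := fun z hz =>
    (hasDerivAt_rankDensity (hx0.trans_le hz.1) (hz.2.trans_lt hy)).sub
      ((hasDerivAt_criticalValue (hx0.trans_le hz.1) (hz.2.trans_lt hy)).const_mul K)
  have hanti : AntitoneOn (fun z => rankDensity d z - K * criticalValue d z) (Set.Icc x y) := by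
    refine antitoneOn_of_deriv_nonpos (convex_Icc _ _)
      (fun z hz => (hder z hz).continuousAt.continuousWithinAt)
      (fun z hz => (hder z (interior_subset hz)).differentiableAt.differentiableWithinAt)
      fun z hz => ?_
    have hz := interior_subset hz
    rw [(hder z hz).deriv]
    have h1 : 0 ≤ rootSlope d z / z ^ (d + 1) :=
      (div_pos (h.rootSlope_pos hd (hx.trans hz.1) (hz.2.trans_lt hy))
        (pow_pos (hx0.trans_le hz.1) _)).le
    have h2 : (1 - z ^ (d + 1)) / ((d : ℝ) + 1) ≤ K := by
      rw [hK]
      refine div_le_div_of_nonneg_right ?_ (by positivity)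
      linarith [pow_le_pow_left₀ hx0.le hz.1 (d + 1)]
    nlinarith
  have := hanti ⟨le_rfl, hxy⟩ ⟨hxy, le_rfl⟩ hxy
  simp only at this
  rw [← hK]
  linarith

lemma pow_sub_pow_le {x y : ℝ} (hx : 0 ≤ x) (hxy : x ≤ y) (hy : y ≤ 1) (k : ℕ) :
    y ^ k - x ^ k ≤ k * (y - x) := by
  induction k with
  | zero => simp
  | succ k ih =>
    have h1 : x ^ k ≤ 1 := pow_le_one₀ hx (hxy.trans hy)
    have h2 : 0 ≤ y ^ k - x ^ k := sub_nonneg.2 (pow_le_pow_left₀ hx hxy k)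
    have e : y ^ (k + 1) - x ^ (k + 1) = y * (y ^ k - x ^ k) + (y - x) * x ^ k := by ring
    rw [e]
    push_cast
    nlinarith

/-- Above the critical root, a suitable Riemann sum exceeds the density of the deficit. -/
lemma IsCriticalRoot.exists_partition (hd : 2 ≤ d) (h : IsCriticalRoot d b) {q : ℝ} (hq : b < q)
    (hq1 : q < 1) : ∃ (m : ℕ) (z : ℕ → ℝ), z 0 = q ∧ (∀ i ≤ m, b ≤ z i ∧ z i < 1) ∧
      (∀ i < m, z i ≤ z (i + 1)) ∧ (d : ℝ) + 1 - criticalValue d q <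
        ∑ i ∈ Finset.range m, (criticalValue d (z (i + 1)) - criticalValue d (z i)) *
          (1 - z (i + 1) ^ (d + 1)) := by
  have hq0 := h.1.1.trans hq
  have hd0 : (0 : ℝ) < (d : ℝ) + 1 := by positivity
  have hgap : rankDensity d q < criticalValue d q / (d + 1) := by
    have h1 := h.rootFun_pos hd hq hq1
    have h2 : criticalValue d q * q ^ d = -Real.log (1 - q) := by
      rw [criticalValue, div_mul_cancel₀ _ (pow_ne_zero d hq0.ne')]
    -- The density of the surplus of faces over rank is `rootFun d q / (d + 1)`.
    have h3 : criticalValue d q / (d + 1) - rankDensity d q = rootFun d q / (d + 1) := by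
      unfold rankDensity rootFun
      rw [show criticalValue d q * (1 - q ^ (d + 1)) = criticalValue d q -
        criticalValue d q * q ^ d * q by ring, h2]
      field_simp
      ring
    have := div_pos h1 hd0
    linarith
  -- Half of the gap `δ` pays for stopping at `Q < 1`, the other half for the mesh of the partition.
  obtain ⟨δ, hδ⟩ : ∃ δ, δ = criticalValue d q / (d + 1) - rankDensity d q := ⟨_, rfl⟩
  have hδ0 : 0 < δ := by linarith
  have hlim : Tendsto (fun x : ℝ => (1 - x) * Real.log (1 - x) + x) (𝓝[<] 1) (𝓝 1) := by
    have hc : Continuous fun x : ℝ => (1 - x) * Real.log (1 - x) + x :=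
      (Real.continuous_mul_log.comp (continuous_const.sub continuous_id)).add continuous_id
    have := hc.tendsto 1
    simp only [sub_self, Real.log_zero, mul_zero, zero_add] at this
    exact this.mono_left nhdsWithin_le_nhds
  have hev : ∀ᶠ x in 𝓝[<] (1 : ℝ), q < x := (eventually_gt_nhds hq1).filter_mono nhdsWithin_le_nhds
  obtain ⟨Q, ⟨hQ, hqQ⟩, hQ1⟩ := (((hlim.eventually_const_lt
    (show 1 - δ / 2 < 1 by linarith)).and hev).and self_mem_nhdsWithin).exists
  have hQ1 : Q < 1 := hQ1
  have hQd : 1 - δ / 2 < rankDensity d Q := by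
    have h1 : 0 ≤ criticalValue d Q * (1 - Q ^ (d + 1)) / (d + 1) :=
      div_nonneg (mul_nonneg (criticalValue_pos (hq0.trans hqQ) hQ1).le
        (sub_nonneg.2 (pow_le_one₀ (hq0.trans hqQ).le hQ1.le))) hd0.le
    unfold rankDensity
    linarith
  have hmono := h.strictMonoOn_criticalValue hd
  obtain ⟨T, hT⟩ : ∃ T, T = criticalValue d Q - criticalValue d q := ⟨_, rfl⟩
  have hT0 : 0 < T := by
    rw [hT]; exact sub_pos.2 (hmono ⟨hq.le, hq1⟩ ⟨(hq.trans hqQ).le, hQ1⟩ hqQ)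
  obtain ⟨m, hm⟩ := exists_nat_gt (T / (δ / 2))
  have hm0 : (0 : ℝ) < m := (div_pos hT0 (half_pos hδ0)).trans hm
  rw [div_lt_iff₀ (half_pos hδ0)] at hm
  obtain ⟨z, hz⟩ : ∃ z : ℕ → ℝ, z = fun i : ℕ => q + i * ((Q - q) / m) := ⟨_, rfl⟩
  have hstep : 0 < (Q - q) / m := div_pos (by linarith) hm0
  have hz0 : z 0 = q := by simp [hz]
  have hzm : z m = Q := by rw [hz]; field_simp; ring
  have hzs : ∀ i, z (i + 1) - z i = (Q - q) / m := by intro i; rw [hz]; push_cast; ring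
  have hzmono : Monotone z := monotone_nat_of_le_succ fun i => by linarith [hzs i]
  have hzb : ∀ i ≤ m, b ≤ z i ∧ z i < 1 := fun i hi =>
    ⟨hq.le.trans (hz0 ▸ hzmono (Nat.zero_le i)), (hzmono hi).trans_lt (hzm ▸ hQ1)⟩
  refine ⟨m, z, hz0, hzb, fun i _ => hzmono (Nat.le_succ i), ?_⟩
  -- The sum uses right endpoints, since growth of the rank is bounded by the survival at the larger
  -- parameter. Passing from left to right endpoints costs the subtracted term with denominator `m`.
  have hterm : ∀ i ∈ Finset.range m,
      ((d : ℝ) + 1) * ((rankDensity d (z (i + 1)) - rankDensity d (z i)) -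
        (criticalValue d (z (i + 1)) - criticalValue d (z i)) / m) ≤
      (criticalValue d (z (i + 1)) - criticalValue d (z i)) * (1 - z (i + 1) ^ (d + 1)) := by
    intro i hi
    have hi := Finset.mem_range.1 hi
    have h1 := h.rankDensity_sub_le hd (hzb i hi.le).1 (hzmono (Nat.le_succ i)) (hzb (i + 1) hi).2
    have h2 : 0 ≤ criticalValue d (z (i + 1)) - criticalValue d (z i) :=
      sub_nonneg.2 (hmono.monotoneOn ⟨(hzb i hi.le).1, (hzb i hi.le).2⟩
        ⟨(hzb (i + 1) hi).1, (hzb (i + 1) hi).2⟩ (hzmono (Nat.le_succ i)))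
    have h3 := pow_sub_pow_le (h.1.1.le.trans (hzb i hi.le).1) (hzmono (Nat.le_succ i))
      (hzb (i + 1) hi).2.le (d + 1)
    have h4 : z (i + 1) - z i ≤ 1 / m := by
      rw [hzs]
      exact div_le_div_of_nonneg_right (by linarith) hm0.le
    have h5 : z (i + 1) ^ (d + 1) - z i ^ (d + 1) ≤ ((d : ℝ) + 1) * (1 / m) := by
      push_cast at h3
      exact h3.trans (mul_le_mul_of_nonneg_left h4 hd0.le)
    rw [← mul_div_assoc, le_div_iff₀ hd0] at h1
    have h6 := mul_le_mul_of_nonneg_left h5 h2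
    have e : (criticalValue d (z (i + 1)) - criticalValue d (z i)) * (((d : ℝ) + 1) * (1 / m)) =
      ((d : ℝ) + 1) * ((criticalValue d (z (i + 1)) - criticalValue d (z i)) / m) := by ring
    rw [e] at h6
    nlinarith
  refine lt_of_lt_of_le ?_ (Finset.sum_le_sum hterm)
  rw [← Finset.mul_sum, Finset.sum_sub_distrib, ← Finset.sum_div,
    Finset.sum_range_sub (fun i => rankDensity d (z i)),
    Finset.sum_range_sub (fun i => criticalValue d (z i)), hz0, hzm, ← hT]
  have h7 : T / m < δ / 2 := by rw [div_lt_iff₀ hm0]; linarith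
  have h8 : 1 - criticalValue d q / (d + 1) < rankDensity d Q - rankDensity d q - T / m := by
    linarith
  calc (d : ℝ) + 1 - criticalValue d q = (d + 1) * (1 - criticalValue d q / (d + 1)) := by
        field_simp
    _ < _ := mul_lt_mul_of_pos_left h8 hd0

end Root

/-! ### Numerical values -/

section Numerics

lemma log_approx {x : ℝ} (h0 : 0 ≤ x) (h1 : x < 1) (n : ℕ) :
    -Real.log (1 - x) ≤ ∑ i ∈ Finset.range n, x ^ (i + 1) / (i + 1) + x ^ (n + 1) / (1 - x) ∧
    ∑ i ∈ Finset.range n, x ^ (i + 1) / (i + 1) - x ^ (n + 1) / (1 - x) ≤ -Real.log (1 - x) := by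
  have h := Real.abs_log_sub_add_sum_range_le (show |x| < 1 by rwa [abs_of_nonneg h0]) n
  rw [abs_of_nonneg h0, abs_le] at h
  constructor <;> linarith [h.1, h.2]

/-- Scaling by a power of 2 moves the argument close to 1, where the logarithm series converges
quickly; known bounds for ln 2 do the rest. -/
lemma neg_log_eq {a x : ℝ} (k : ℕ) (hx : x < 1) (h : a = (1 - x) / 2 ^ k) :
    -Real.log a = -Real.log (1 - x) + k * Real.log 2 := by
  rw [h, Real.log_div (by linarith) (by positivity), Real.log_pow]
  ring

/-- The test points here and below lie half a unit of the last digit on either side of the rounded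
root. -/
lemma rootFun_two_neg : rootFun 2 0.8834135 < 0 := by
  have h1 := neg_log_eq (a := 1 - 0.8834135) (x := 0.067308) 3 (by norm_num) (by norm_num)
  have h2 := (log_approx (x := 0.067308) (by norm_num) (by norm_num) 7).1
  norm_num [Finset.sum_range_succ] at h2
  have h3 := Real.log_two_lt_d9
  unfold rootFun
  rw [h1]
  push_cast
  norm_num at *
  linarith

lemma rootFun_two_pos : 0 < rootFun 2 0.8834145 := by
  have h1 := neg_log_eq (a := 1 - 0.8834145) (x := 0.067316) 3 (by norm_num) (by norm_num)
  have h2 := (log_approx (x := 0.067316) (by norm_num) (by norm_num) 7).2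
  norm_num [Finset.sum_range_succ] at h2
  have h3 := Real.log_two_gt_d9
  unfold rootFun
  rw [h1]
  push_cast
  norm_num at *
  linarith

lemma rootFun_three_neg : rootFun 3 0.9724975 < 0 := by
  have h1 := neg_log_eq (a := 1 - 0.9724975) (x := 0.11992) 5 (by norm_num) (by norm_num)
  have h2 := (log_approx (x := 0.11992) (by norm_num) (by norm_num) 8).1
  norm_num [Finset.sum_range_succ] at h2
  have h3 := Real.log_two_lt_d9
  unfold rootFun
  rw [h1]
  push_cast
  norm_num at *
  linarith

lemma rootFun_three_pos : 0 < rootFun 3 0.9724985 := by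
  have h1 := neg_log_eq (a := 1 - 0.9724985) (x := 0.119952) 5 (by norm_num) (by norm_num)
  have h2 := (log_approx (x := 0.119952) (by norm_num) (by norm_num) 8).2
  norm_num [Finset.sum_range_succ] at h2
  have h3 := Real.log_two_gt_d9
  unfold rootFun
  rw [h1]
  push_cast
  norm_num at *
  linarith

lemma IsCriticalRoot.mem_of_rootFun {d : ℕ} (hd : 2 ≤ d) {b x y : ℝ} (h : IsCriticalRoot d b)
    (hx : 0 < x) (hxy : x < y) (hy : y < 1) (hfx : rootFun d x < 0) (hfy : 0 < rootFun d y) :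
    x < b ∧ b < y := by
  obtain ⟨b', hb', h1⟩ := exists_isCriticalRoot_between hx hxy hy hfx hfy
  rwa [h.unique hd hb']

lemma IsCriticalRoot.two_mem {b : ℝ} (h : IsCriticalRoot 2 b) : 0.8834135 < b ∧ b < 0.8834145 :=
  h.mem_of_rootFun le_rfl (by norm_num) (by norm_num) (by norm_num) rootFun_two_neg rootFun_two_pos

lemma IsCriticalRoot.three_mem {b : ℝ} (h : IsCriticalRoot 3 b) : 0.9724975 < b ∧ b < 0.9724985 :=
  h.mem_of_rootFun (by norm_num) (by norm_num) (by norm_num) (by norm_num) rootFun_three_neg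
    rootFun_three_pos

lemma IsCriticalRoot.criticalValue_two {b : ℝ} (h : IsCriticalRoot 2 b) :
    |criticalValue 2 b - 2.75381| ≤ 0.000005 := by
  obtain ⟨h1, h2⟩ := h.two_mem
  -- The root equation eliminates the logarithm, leaving a rational function of the root.
  have e : criticalValue 2 b = 3 / ((3 - 2 * b) * b) := by
    have h3 : (3 : ℝ) - 2 * b ≠ 0 := by linarith
    have h4 : b ≠ 0 := by linarith
    rw [criticalValue, h.2]
    push_cast
    rw [show (2 : ℝ) + 1 = 3 by norm_num]
    field_simp
  have hpos : 0 < (3 - 2 * b) * b := mul_pos (by linarith) (by linarith)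
  have hl : 3 / ((3 - 2 * b) * b) ≤ 2.753815 := by
    rw [div_le_iff₀ hpos]
    nlinarith [mul_pos (sub_pos.2 h1) (sub_pos.2 h2)]
  have hr : 2.753805 ≤ 3 / ((3 - 2 * b) * b) := by
    rw [le_div_iff₀ hpos]
    nlinarith [mul_pos (sub_pos.2 h1) (sub_pos.2 h2)]
  rw [e, abs_le]
  constructor <;> linarith

lemma IsCriticalRoot.criticalValue_three {b : ℝ} (h : IsCriticalRoot 3 b) :
    |criticalValue 3 b - 3.90708| ≤ 0.000005 := by
  obtain ⟨h1, h2⟩ := h.three_mem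
  have e : criticalValue 3 b = 4 / ((4 - 3 * b) * b ^ 2) := by
    have h3 : (4 : ℝ) - 3 * b ≠ 0 := by linarith
    have h4 : b ≠ 0 := by linarith
    rw [criticalValue, h.2]
    push_cast
    rw [show (3 : ℝ) + 1 = 4 by norm_num]
    field_simp
  have hpos : 0 < (4 - 3 * b) * b ^ 2 := mul_pos (by linarith) (pow_pos (by linarith) 2)
  -- The cubic (4 - 3x)x² decreases beyond 8/9.
  have hanti : ∀ x y : ℝ, 0.9 ≤ x → x ≤ y → (4 - 3 * y) * y ^ 2 ≤ (4 - 3 * x) * x ^ 2 := by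
    intro x y hx hxy
    have : 0 ≤ 3 * (x ^ 2 + x * y + y ^ 2) - 4 * (x + y) := by nlinarith
    nlinarith [mul_nonneg (sub_nonneg.2 hxy) this]
  have hl : 4 / ((4 - 3 * b) * b ^ 2) ≤ 3.907085 := by
    rw [div_le_iff₀ hpos]
    have := hanti b 0.9724985 (by linarith) h2.le
    norm_num at this ⊢
    linarith
  have hr : 3.907075 ≤ 4 / ((4 - 3 * b) * b ^ 2) := by
    rw [le_div_iff₀ hpos]
    have := hanti 0.9724975 b (by norm_num) h1.le
    norm_num at this ⊢
    linarith
  rw [e, abs_le]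
  constructor <;> linarith

end Numerics

/-! ### Asymptotic expansions -/

section Asymptotic

variable {d : ℕ} {b : ℝ}

/-- An a priori bound from the sign of `rootFun` at 1 - 2E with E = e^(-(d+1)): the value there is
-ln 2 + 2(d+1)²E - 2dE ln 2, which is negative since (d+1)²E ≤ 1/8. -/
lemma IsCriticalRoot.le_two_mul_exp (hd : 2 ≤ d) (h : IsCriticalRoot d b)
    (hw : ((d : ℝ) + 1) ^ 2 * Real.exp (-((d : ℝ) + 1)) ≤ 1 / 8) :
    1 - b ≤ 2 * Real.exp (-((d : ℝ) + 1)) := by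
  obtain ⟨E, hE⟩ : ∃ E, E = Real.exp (-((d : ℝ) + 1)) := ⟨_, rfl⟩
  have hd0 : (0 : ℝ) ≤ d := Nat.cast_nonneg d
  have hE0 : 0 < E := hE ▸ Real.exp_pos _
  rw [← hE] at hw ⊢
  by_contra hcon
  have hb : b < 1 - 2 * E := by linarith
  have h1 := h.rootFun_pos hd hb (by linarith)
  have h2 : rootFun d (1 - 2 * E) =
      (d + 1 - Real.log 2) * (1 + 2 * d * E) - (d + 1) * (1 - 2 * E) := by
    rw [rootFun, sub_sub_cancel, Real.log_mul (by norm_num) hE0.ne', hE, Real.log_exp]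
    ring
  have h3 := Real.log_two_gt_d9
  rw [h2] at h1
  have h4 : 0 ≤ Real.log 2 * (d * E) := by positivity
  nlinarith

/-- Exponentiating the root equation gives a fixed-point equation for 1 - b that can be expanded. -/
lemma IsCriticalRoot.one_sub_eq (h : IsCriticalRoot d b) :
    1 - b = Real.exp (-((d : ℝ) + 1)) *
      Real.exp (((d : ℝ) + 1) ^ 2 * (1 - b) / (1 + d * (1 - b))) := by
  obtain ⟨⟨h0, h1⟩, h2⟩ := h
  have h3 : (0 : ℝ) < 1 + d * (1 - b) := by
    have := mul_nonneg (Nat.cast_nonneg (α := ℝ) d) (sub_nonneg.2 h1.le)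
    linarith
  rw [← Real.exp_add]
  have h4 : -((d : ℝ) + 1) + ((d : ℝ) + 1) ^ 2 * (1 - b) / (1 + d * (1 - b)) =
      Real.log (1 - b) := by
    have h5 : Real.log (1 - b) = -(((d : ℝ) + 1) * b / (1 + d * (1 - b))) := by
      rw [show (1 : ℝ) + d * (1 - b) = d + 1 - d * b by ring, ← h2, neg_neg]
    rw [h5]
    field_simp
    ring
  rw [h4, Real.exp_log (by linarith)]

/-- The second-order expansion of the critical root with an explicit error. -/
lemma IsCriticalRoot.abs_one_sub_sub_le (hd : 2 ≤ d) (h : IsCriticalRoot d b)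
    (hw : ((d : ℝ) + 1) ^ 2 * Real.exp (-((d : ℝ) + 1)) ≤ 1 / 8) :
    |1 - b - Real.exp (-((d : ℝ) + 1)) - ((d : ℝ) + 1) ^ 2 * Real.exp (-((d : ℝ) + 1)) ^ 2| ≤
      8 * (((d : ℝ) + 1) ^ 2 * Real.exp (-((d : ℝ) + 1))) *
        (((d : ℝ) + 1) ^ 2 * Real.exp (-((d : ℝ) + 1)) ^ 2) := by
  have hx2 := h.le_two_mul_exp hd hw
  have heq := h.one_sub_eq
  have hd0 : (0 : ℝ) ≤ d := Nat.cast_nonneg d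
  have hx0 : 0 < 1 - b := by linarith [h.1.2]
  obtain ⟨E, hE⟩ : ∃ E, E = Real.exp (-((d : ℝ) + 1)) := ⟨_, rfl⟩
  obtain ⟨x, hx⟩ : ∃ x, x = 1 - b := ⟨_, rfl⟩
  obtain ⟨D, hD⟩ : ∃ D, D = (d : ℝ) + 1 := ⟨_, rfl⟩
  have hE0 : 0 < E := hE ▸ Real.exp_pos _
  rw [← hE] at hw hx2 heq ⊢
  rw [← hx] at hx2 heq hx0 ⊢
  rw [← hD] at hw heq ⊢
  -- With w = D²E one has x = E e^y and y = w + O(w²), hence x = E(1 + w + O(w²)).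
  obtain ⟨y, hy⟩ : ∃ y, y = D ^ 2 * x / (1 + d * x) := ⟨_, rfl⟩
  obtain ⟨w, hww⟩ : ∃ w, w = D ^ 2 * E := ⟨_, rfl⟩
  rw [← hy] at heq
  have hw0 : 0 ≤ w := by rw [hww]; positivity
  have hden : 1 ≤ 1 + d * x := by nlinarith
  have hy0 : 0 ≤ y := by rw [hy]; positivity
  have hyx : y ≤ D ^ 2 * x := by
    rw [hy]; exact div_le_self (by positivity) hden
  have hy2 : y ≤ 2 * w := by rw [hww]; nlinarith [sq_nonneg D]
  have hy1 : y ≤ 1 / 4 := by rw [hww] at hy2; linarith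
  have hexp := Real.abs_exp_sub_one_sub_id_le (show |y| ≤ 1 by rw [abs_of_nonneg hy0]; linarith)
  rw [abs_le] at hexp
  have hyw : y ≤ w * Real.exp y := by
    rw [hww]
    calc y ≤ D ^ 2 * x := hyx
      _ = D ^ 2 * E * Real.exp y := by rw [heq]; ring
  have hup : Real.exp y - 1 ≤ w + 8 * w ^ 2 := by nlinarith [hexp.2]
  have hlow : w - 8 * w ^ 2 ≤ Real.exp y - 1 := by
    have h1 : y * (1 + d * x) = D ^ 2 * x := by rw [hy]; field_simp
    have h2 : D ^ 2 * E ≤ D ^ 2 * x := by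
      rw [heq]
      exact mul_le_mul_of_nonneg_left (le_mul_of_one_le_right hE0.le (Real.one_le_exp hy0))
        (sq_nonneg D)
    have hdD : (d : ℝ) ≤ D ^ 2 := by rw [hD]; nlinarith
    have h3 : d * x ≤ 2 * w := by
      rw [hww]
      calc d * x ≤ D ^ 2 * (2 * E) := mul_le_mul hdD hx2 hx0.le (sq_nonneg D)
        _ = 2 * (D ^ 2 * E) := by ring
    have h4 : w ≤ y * (1 + 2 * w) := by rw [← hww, ← h1] at h2; nlinarith
    nlinarith [Real.add_one_le_exp y]
  have e : x - E - D ^ 2 * E ^ 2 = E * (Real.exp y - 1 - w) := by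
    rw [hww]
    linear_combination heq
  have e2 : 8 * (D ^ 2 * E) * (D ^ 2 * E ^ 2) = E * (8 * w ^ 2) := by rw [hww]; ring
  rw [e, e2, abs_mul, abs_of_pos hE0]
  refine mul_le_mul_of_nonneg_left (abs_le.2 ⟨?_, ?_⟩) hE0.le <;> linarith

lemma IsCriticalRoot.criticalValue_eq (hd : 1 ≤ d) (h : IsCriticalRoot d b) :
    criticalValue d b = (d + 1) / ((1 + d * (1 - b)) * b ^ (d - 1)) := by
  obtain ⟨d, rfl⟩ : ∃ k, d = k + 1 := ⟨d - 1, by omega⟩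
  obtain ⟨⟨h0, h1⟩, h2⟩ := h
  have h3 : (0 : ℝ) < 1 + (d + 1 : ℕ) * (1 - b) := by
    have := mul_nonneg (Nat.cast_nonneg (α := ℝ) (d + 1)) (sub_nonneg.2 h1.le)
    linarith
  rw [criticalValue, h2, Nat.add_sub_cancel,
    show ((d + 1 : ℕ) : ℝ) + 1 - (d + 1 : ℕ) * b = 1 + (d + 1 : ℕ) * (1 - b) by ring, pow_succ]
  field_simp

/-- The expansion of the critical value with an explicit error. -/
lemma IsCriticalRoot.abs_criticalValue_sub_le (hd : 2 ≤ d) (h : IsCriticalRoot d b)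
    (hw : ((d : ℝ) + 1) ^ 2 * Real.exp (-((d : ℝ) + 1)) ≤ 1 / 8) :
    |criticalValue d b - (((d : ℝ) + 1) - ((d : ℝ) + 1) / Real.exp ((d : ℝ) + 1))| ≤
      96 * ((d : ℝ) ^ 3 / Real.exp (2 * (d : ℝ))) := by
  have hx2 := h.le_two_mul_exp hd hw
  have habs := h.abs_one_sub_sub_le hd hw
  have hd2 : (2 : ℝ) ≤ d := by exact_mod_cast hd
  obtain ⟨h0, h1⟩ := h.1
  have hcv := h.criticalValue_eq (by omega)
  obtain ⟨E, hE⟩ : ∃ E, E = Real.exp (-((d : ℝ) + 1)) := ⟨_, rfl⟩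
  obtain ⟨x, hx⟩ : ∃ x, x = 1 - b := ⟨_, rfl⟩
  have hE0 : 0 < E := hE ▸ Real.exp_pos _
  have hx0 : 0 < x := by linarith
  have hbx : b = 1 - x := by linarith
  have hdE : (d : ℝ) * E ≤ 1 / 8 := by rw [← hE] at hw; nlinarith
  have hfin : E ^ 2 ≤ 1 / Real.exp (2 * (d : ℝ)) := by
    rw [hE, sq, ← Real.exp_add, one_div, ← Real.exp_neg]
    exact Real.exp_le_exp.2 (by linarith)
  have e1 : ((d : ℝ) + 1) / Real.exp ((d : ℝ) + 1) = (d + 1) * E := by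
    rw [hE, Real.exp_neg]; rfl
  rw [← hE] at hw hx2 habs
  rw [← hx] at hx2 habs hcv
  rw [e1]
  have hdx : (d : ℝ) * x ≤ 1 / 4 := by nlinarith
  have hbern : 1 - d * x ≤ b ^ d := by
    have := one_add_mul_le_pow (show (-2 : ℝ) ≤ -x by linarith) d
    rw [hbx]
    calc 1 - d * x = 1 + d * -x := by ring
      _ ≤ (1 + -x) ^ d := this
      _ = _ := by ring
  -- Bernoulli applied to both factors places (1 + dx)b^d within (dx)² of 1. Hence the critical
  -- value is (d+1)(1 - x) up to second order.
  have hlow : 1 - (d * x) ^ 2 ≤ (1 + d * x) * b ^ d := by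
    linarith [mul_le_mul_of_nonneg_left hbern (show (0 : ℝ) ≤ 1 + d * x by positivity)]
  have hupp : (1 + d * x) * b ^ d ≤ 1 := by
    have h3 := one_add_mul_le_pow (show (-2 : ℝ) ≤ x by linarith) d
    calc (1 + d * x) * b ^ d ≤ (1 + x) ^ d * b ^ d :=
          mul_le_mul_of_nonneg_right h3 (pow_nonneg h0.le _)
      _ = ((1 + x) * b) ^ d := (mul_pow _ _ _).symm
      _ ≤ 1 := pow_le_one₀ (by nlinarith) (by nlinarith)
  obtain ⟨P, hP⟩ : ∃ P, P = (1 + d * x) * b ^ (d - 1) := ⟨_, rfl⟩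
  have hPb : P * b = (1 + d * x) * b ^ d := by
    rw [hP, mul_assoc, ← pow_succ, Nat.sub_add_cancel (by omega)]
  have hP0 : 0 < P := by rw [hP]; positivity
  have hP2 : 1 / 2 ≤ P := by
    have h3 : P * b ≤ P := mul_le_of_le_one_right hP0.le h1.le
    have h4 : ((d : ℝ) * x) ^ 2 ≤ (1 / 4) ^ 2 := pow_le_pow_left₀ (by positivity) hdx 2
    linarith
  rw [← hP] at hcv
  have e2 : criticalValue d b - ((d : ℝ) + 1) * (1 - x) = (d + 1) * (1 - P * b) / P := by
    rw [hcv, ← hbx]; field_simp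
  have hA0 : 0 ≤ criticalValue d b - ((d : ℝ) + 1) * (1 - x) := by
    rw [e2]
    exact div_nonneg (mul_nonneg (by linarith) (by linarith)) hP0.le
  have hA1 : criticalValue d b - ((d : ℝ) + 1) * (1 - x) ≤ 8 * (d + 1) ^ 3 * E ^ 2 := by
    rw [e2, div_le_iff₀ hP0]
    have h4 : 1 - P * b ≤ (d * x) ^ 2 := by linarith
    have h5 : (d * x) ^ 2 ≤ 4 * (d + 1) ^ 2 * E ^ 2 := by
      have : (d : ℝ) * x ≤ 2 * ((d + 1) * E) := by nlinarith
      calc ((d : ℝ) * x) ^ 2 ≤ (2 * ((d + 1) * E)) ^ 2 := pow_le_pow_left₀ (by positivity) this 2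
        _ = _ := by ring
    calc ((d : ℝ) + 1) * (1 - P * b) ≤ (d + 1) * (4 * (d + 1) ^ 2 * E ^ 2) :=
          mul_le_mul_of_nonneg_left (h4.trans h5) (by linarith)
      _ = 8 * (d + 1) ^ 3 * E ^ 2 * (1 / 2) := by ring
      _ ≤ _ := mul_le_mul_of_nonneg_left hP2 (by positivity)
  have hB : |x - E| ≤ 2 * ((d + 1) ^ 2 * E ^ 2) := by
    have h6 : 8 * (((d : ℝ) + 1) ^ 2 * E) * (((d : ℝ) + 1) ^ 2 * E ^ 2) ≤
        1 * (((d : ℝ) + 1) ^ 2 * E ^ 2) := mul_le_mul_of_nonneg_right (by linarith) (by positivity)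
    have h7 : 0 ≤ ((d : ℝ) + 1) ^ 2 * E ^ 2 := by positivity
    rw [abs_le] at habs ⊢
    constructor <;> linarith [habs.1, habs.2]
  have hB' : |((d : ℝ) + 1) * (x - E)| ≤ 2 * (d + 1) ^ 3 * E ^ 2 := by
    rw [abs_mul, abs_of_nonneg (by linarith : (0 : ℝ) ≤ d + 1)]
    calc ((d : ℝ) + 1) * |x - E| ≤ (d + 1) * (2 * ((d + 1) ^ 2 * E ^ 2)) :=
          mul_le_mul_of_nonneg_left hB (by linarith)
      _ = _ := by ring
  have hC : |criticalValue d b - ((d : ℝ) + 1 - (d + 1) * E)| ≤ 10 * (d + 1) ^ 3 * E ^ 2 := by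
    rw [abs_le] at hB' ⊢
    constructor <;> linarith [hB'.1, hB'.2]
  refine hC.trans ?_
  -- For d ≥ 2, d + 1 ≤ 3d/2, so the constant 96 is far from sharp.
  have hd3 : 10 * ((d : ℝ) + 1) ^ 3 ≤ 96 * d ^ 3 := by
    have : ((d : ℝ) + 1) ^ 3 ≤ (3 / 2 * d) ^ 3 := pow_le_pow_left₀ (by linarith) (by linarith) 3
    nlinarith [pow_pos (show (0 : ℝ) < d by linarith) 3]
  calc 10 * ((d : ℝ) + 1) ^ 3 * E ^ 2 ≤ 96 * d ^ 3 * (1 / Real.exp (2 * (d : ℝ))) :=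
        mul_le_mul hd3 hfin (by positivity) (by positivity)
    _ = _ := by ring

lemma tendsto_sq_mul_exp_neg :
    Tendsto (fun d : ℕ => ((d : ℝ) + 1) ^ 2 * Real.exp (-((d : ℝ) + 1))) atTop (𝓝 0) :=
  (Real.tendsto_pow_mul_exp_neg_atTop_nhds_zero 2).comp
    (tendsto_atTop_add_const_right _ 1 tendsto_natCast_atTop_atTop)

end Asymptotic

/-! ### The expected nullity and its concentration -/

section Nullity

variable {F : Type*} [Field F] {d : ℕ}

lemma length_allFaces (n d : ℕ) : (allFaces (Fin n) d).length = n.choose (d + 1) := by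
  simp [allFaces]

lemma card_toFinset_allFaces (n d : ℕ) :
    (allFaces (Fin n) d).toFinset.card = n.choose (d + 1) := by
  rw [List.toFinset_card_of_nodup (nodup_allFaces d), length_allFaces]

/-- A dead side forces an escape from the span. Escapes are least likely at the right end `t`, where
each of the C(n, d+1) faces escapes with probability at least `1 - survival d t r ^ (d + 1) - ε`. -/
lemma eventually_le_avg_boundaryRank_sub (F : Type*) [Field F] (hd : 1 ≤ d) {s t : ℝ} (hs : 0 ≤ s)
    (hst : s ≤ t) (r : ℕ) {ε : ℝ} (hε : 0 < ε) :
    ∀ᶠ n : ℕ in atTop,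
      (t - s) / n * (n.choose (d + 1) * (1 - survival d t r ^ (d + 1) - ε)) ≤
        avg (t / n) (allFaces (Fin n) d) (fun X => (boundaryRank F d X : ℝ)) ∅ -
        avg (s / n) (allFaces (Fin n) d) (fun X => (boundaryRank F d X : ℝ)) ∅ := by
  filter_upwards [eventually_le_prob_dead (hs.trans hst) d r hε,
    eventually_div_le (hs.trans hst) one_pos] with n h1 hp
  have hst' : s / n ≤ t / n := div_le_div_of_nonneg_right hst (Nat.cast_nonneg n)
  have h2 := sum_marginal_le_avg_sub (l := allFaces (Fin n) d)
    (f := fun X => (boundaryRank F d X : ℝ)) (div_nonneg hs (Nat.cast_nonneg n)) hst' hp.2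
    (nodup_allFaces d) antitone_marginal_boundaryRank ∅
  refine le_trans ?_ h2
  rw [← sub_div]
  refine mul_le_mul_of_nonneg_left ?_ (div_nonneg (sub_nonneg.2 hst) (Nat.cast_nonneg n))
  rw [← card_toFinset_allFaces n d, ← nsmul_eq_mul]
  refine Finset.card_nsmul_le_sum _ _ _ fun σ hσ => ?_
  have hσ : σ.card = d + 1 := mem_allFaces.1 (List.mem_toFinset.1 hσ)
  refine (h1 σ hσ).trans (avg_mono hp.1 hp.2 (fun X => ?_) ∅)
  rw [marginal_boundaryRank]
  exact ind_mono fun h => escapesSpan_of_dead hd hσ h.1 h.2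

lemma avg_card_filter (n d : ℕ) (p : ℝ) : avg p (allFaces (Fin n) d)
    (fun X => ((X.filter fun s => s.card = d + 1).card : ℝ)) ∅ = n.choose (d + 1) * p := by
  have e : ∀ X : Finset (Finset (Fin n)), ((X.filter fun s => s.card = d + 1).card : ℝ) =
      ∑ σ ∈ (allFaces (Fin n) d).toFinset, ind (fun X => {σ} ⊆ X) X := by
    intro X
    have h1 : (X.filter fun s => s.card = d + 1) =
        (allFaces (Fin n) d).toFinset.filter fun σ => {σ} ⊆ X := by
      ext σ
      simp [mem_allFaces, and_comm]
    rw [h1, Finset.card_filter, Nat.cast_sum]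
    refine Finset.sum_congr rfl fun σ _ => ?_
    by_cases h : {σ} ⊆ X <;> simp [ind, h]
  simp only [e]
  rw [avg_sum, Finset.sum_congr rfl (g := fun _ => p), Finset.sum_const, nsmul_eq_mul,
    card_toFinset_allFaces]
  intro σ hσ
  have := prob_subset (p := p) (d := d) (A := {σ}) (by
    simpa using mem_allFaces.1 (List.mem_toFinset.1 hσ))
  simpa [prob] using this

lemma avg_nullity (n : ℕ) (p : ℝ) : avg p (allFaces (Fin n) d) (nullity F d) ∅ =
    n.choose (d + 1) * p - avg p (allFaces (Fin n) d) (fun X => (boundaryRank F d X : ℝ)) ∅ := by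
  rw [← avg_card_filter, ← avg_sub]
  rfl

/-- Chebyshev's inequality for the nullity. -/
lemma prob_nullity_nonpos_mul_le {n : ℕ} {p : ℝ} (h0 : 0 ≤ p) (h1 : p ≤ 1)
    (hm : 0 ≤ avg p (allFaces (Fin n) d) (nullity F d) ∅) :
    prob p d (fun X : Finset (Finset (Fin n)) => nullity F d X ≤ 0) *
      avg p (allFaces (Fin n) d) (nullity F d) ∅ ^ 2 ≤ n.choose (d + 1) * p := by
  obtain ⟨m, hmdef⟩ : ∃ m, m = avg p (allFaces (Fin n) d) (nullity F d) ∅ := ⟨_, rfl⟩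
  have hvar := avg_sq_le (l := allFaces (Fin n) d) h0 h1
    (abs_marginal_nullity_le (F := F) (d := d)) ∅ (nodup_allFaces d)
  rw [length_allFaces, ← hmdef] at hvar
  rw [← hmdef] at hm ⊢
  have h2 : prob p d (fun X : Finset (Finset (Fin n)) => nullity F d X ≤ 0) * m ^ 2 =
      avg p (allFaces (Fin n) d)
        (fun X => m ^ 2 * ind (fun X : Finset (Finset (Fin n)) => nullity F d X ≤ 0) X) ∅ := by
    rw [avg_const_mul, mul_comm]
    rfl
  have h3 : avg p (allFaces (Fin n) d)
      (fun X => (nullity F d X ^ 2 - (2 * m) * nullity F d X) + m ^ 2) ∅ =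
      avg p (allFaces (Fin n) d) (fun X => nullity F d X ^ 2) ∅ - m ^ 2 := by
    rw [avg_add, avg_sub, avg_const_mul, avg_const]
    rw [← hmdef]
    ring
  rw [h2]
  -- Chebyshev pointwise: where the nullity is nonpositive, m² is at most its squared distance from
  -- the mean `m ≥ 0`.
  refine (avg_mono h0 h1 (fun X => ?_) ∅).trans (h3.le.trans (by linarith))
  by_cases hX : nullity F d X ≤ 0
  · rw [ind_of (P := fun X : Finset (Finset (Fin n)) => nullity F d X ≤ 0) hX]
    nlinarith [sq_nonneg (nullity F d X)]
  · rw [ind_of_not (P := fun X : Finset (Finset (Fin n)) => nullity F d X ≤ 0) hX]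
    nlinarith [sq_nonneg (nullity F d X - m)]

/-- Above the critical value the expected nullity is of order `n ^ d`. -/
lemma IsCriticalRoot.exists_eventually_le_avg_nullity (F : Type*) [Field F] (hd : 2 ≤ d) {b c : ℝ}
    (h : IsCriticalRoot d b) (hc : criticalValue d b < c) :
    ∃ κ > 0, ∀ᶠ n : ℕ in atTop,
      κ * n.choose d ≤ avg (c / n) (allFaces (Fin n) d) (nullity F d) ∅ := by
  obtain ⟨q, hq, hq1, rfl⟩ := h.exists_criticalValue_eq hc
  obtain ⟨m, z, hz0, hzb, hzmono, hsum⟩ := h.exists_partition hd hq hq1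
  have hmono := (h.strictMonoOn_criticalValue hd).monotoneOn
  have hΔ : ∀ i < m, criticalValue d (z i) ≤ criticalValue d (z (i + 1)) := fun i hi =>
    hmono ⟨(hzb i hi.le).1, (hzb i hi.le).2⟩ ⟨(hzb (i + 1) hi).1, (hzb (i + 1) hi).2⟩ (hzmono i hi)
  have hpos : ∀ i ≤ m, 0 < criticalValue d (z i) := fun i hi =>
    criticalValue_pos (h.1.1.trans_le (hzb i hi).1) (hzb i hi).2
  obtain ⟨S, hS⟩ : ∃ S, S = ∑ i ∈ Finset.range m,
    (criticalValue d (z (i + 1)) - criticalValue d (z i)) * (1 - z (i + 1) ^ (d + 1)) := ⟨_, rfl⟩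
  rw [← hS] at hsum
  obtain ⟨T, hT⟩ : ∃ T, T = criticalValue d (z m) - criticalValue d (z 0) := ⟨_, rfl⟩
  have hT0 : 0 ≤ T := by
    rw [hT, ← Finset.sum_range_sub (fun i => criticalValue d (z i))]
    exact Finset.sum_nonneg fun i hi => sub_nonneg.2 (hΔ i (Finset.mem_range.1 hi))
  obtain ⟨G, hG⟩ : ∃ G, G = S - (d + 1 - criticalValue d q) := ⟨_, rfl⟩
  have hG0 : 0 < G := by linarith
  -- Each parameter step loses `2 * ε`, once for the limit of the survival probabilities and once
  -- for finite `n`. This choice keeps the total loss below G/2.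
  obtain ⟨ε, hε⟩ : ∃ ε, ε = G / (4 * (T + 1)) := ⟨_, rfl⟩
  have hε0 : 0 < ε := by rw [hε]; positivity
  have hTε : 2 * ε * T ≤ G / 2 := by
    rw [hε, mul_div_assoc', div_mul_eq_mul_div, div_le_iff₀ (by positivity)]
    nlinarith
  have hstep : ∀ i ∈ Finset.range m, ∀ᶠ n : ℕ in atTop,
      (criticalValue d (z (i + 1)) - criticalValue d (z i)) / n *
        (n.choose (d + 1) * (1 - z (i + 1) ^ (d + 1) - 2 * ε)) ≤
      avg (criticalValue d (z (i + 1)) / n) (allFaces (Fin n) d)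
        (fun X => (boundaryRank F d X : ℝ)) ∅ -
      avg (criticalValue d (z i) / n) (allFaces (Fin n) d)
        (fun X => (boundaryRank F d X : ℝ)) ∅ := by
    intro i hi
    have hi := Finset.mem_range.1 hi
    obtain ⟨r, hr⟩ := h.exists_survival_pow_le hd (hzb (i + 1) hi).1 (hzb (i + 1) hi).2 hε0
    filter_upwards [eventually_le_avg_boundaryRank_sub F (by omega : 1 ≤ d) (hpos i hi.le).le
      (hΔ i hi) r hε0] with n hn
    refine le_trans ?_ hn
    refine mul_le_mul_of_nonneg_left (mul_le_mul_of_nonneg_left (by linarith)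
      (Nat.cast_nonneg _)) (div_nonneg (sub_nonneg.2 (hΔ i hi)) (Nat.cast_nonneg _))
  have hd0 : (0 : ℝ) < (d : ℝ) + 1 := by positivity
  -- Of the remaining G/2, another G/4 is given up to absorb the factor 1 - d/n from C(n, d+1)/n.
  refine ⟨G / (4 * (d + 1)), by positivity, ?_⟩
  have hlim : Tendsto (fun n : ℕ => (1 - (d : ℝ) / n) * (d + 1 + G / 2)) atTop
      (𝓝 ((1 - 0) * (d + 1 + G / 2))) :=
    (tendsto_const_nhds.sub (tendsto_const_div_atTop_nhds_zero_nat _)).mul_const _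
  filter_upwards [(Filter.eventually_all_finset _).2 hstep, eventually_ge_atTop (d + 1),
    hlim.eventually_const_lt (show (d : ℝ) + 1 + G / 4 < (1 - 0) * (d + 1 + G / 2) by linarith),
    eventually_div_le (hpos m le_rfl).le one_pos]
    with n hn hnd hlarge hp
  have hn0 : (0 : ℝ) < n := by exact_mod_cast (by omega : 0 < n)
  -- The increments telescope to the rank at the last parameter, at most C(n, d), minus the rank at
  -- `c / n`.
  have htel := Finset.sum_le_sum hn
  rw [Finset.sum_range_sub (fun i => avg (criticalValue d (z i) / n) (allFaces (Fin n) d)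
        (fun X => (boundaryRank F d X : ℝ)) ∅), hz0] at htel
  have hrank : avg (criticalValue d (z m) / n) (allFaces (Fin n) d)
      (fun X => (boundaryRank F d X : ℝ)) ∅ ≤ n.choose d := by
    refine avg_le_of_le hp.1 hp.2 (fun X => ?_) ∅
    have := boundaryRank_le (F := F) (d := d) (X := X)
    rw [Fintype.card_fin] at this
    exact_mod_cast this
  have hchoose : (n.choose (d + 1) : ℝ) = n.choose d * (n - d) / (d + 1) := by
    rw [eq_div_iff hd0.ne']
    have := Nat.choose_succ_right_eq n d
    rw [← Nat.cast_sub (by omega : d ≤ n)]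
    exact_mod_cast this
  have hL : ∑ i ∈ Finset.range m, (criticalValue d (z (i + 1)) - criticalValue d (z i)) / n *
        (n.choose (d + 1) * (1 - z (i + 1) ^ (d + 1) - 2 * ε)) =
      n.choose (d + 1) / n * (S - 2 * ε * T) := by
    rw [hS, hT, ← Finset.sum_range_sub (fun i => criticalValue d (z i)), Finset.mul_sum,
      ← Finset.sum_sub_distrib, Finset.mul_sum]
    refine Finset.sum_congr rfl fun i _ => ?_
    ring
  rw [hL] at htel
  rw [avg_nullity]
  have hCn : (0 : ℝ) ≤ n.choose (d + 1) / n := by positivity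
  have h5 : n.choose (d + 1) / n * ((d : ℝ) + 1 + G / 2) ≤
      n.choose (d + 1) / n * (criticalValue d q + (S - 2 * ε * T)) :=
    mul_le_mul_of_nonneg_left (by linarith) hCn
  have h6 : (n.choose (d + 1) : ℝ) / n * ((d : ℝ) + 1 + G / 2) =
      n.choose d / (d + 1) * ((1 - (d : ℝ) / n) * (d + 1 + G / 2)) := by
    rw [hchoose]
    field_simp
  have h7 : (n.choose d : ℝ) / (d + 1) * (d + 1 + G / 4) ≤
      n.choose d / (d + 1) * ((1 - (d : ℝ) / n) * (d + 1 + G / 2)) :=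
    mul_le_mul_of_nonneg_left hlarge.le (by positivity)
  have h8 : (n.choose d : ℝ) / (d + 1) * (d + 1 + G / 4) =
      n.choose d + G / (4 * (d + 1)) * n.choose d := by
    field_simp
  have h9 : (n.choose (d + 1) : ℝ) * (criticalValue d q / n) =
      n.choose (d + 1) / n * criticalValue d q := by ring
  rw [h9]
  nlinarith

/-- The weights of the finite average are the masses of singletons. Only a finite union of
singletons inside the event is measured, so the event itself need not be shown measurable. -/
lemma ofReal_prob_le {n : ℕ} (p : unitInterval) {P : Finset (Finset (Fin n)) → Prop}
    {R : Set (Finset (Fin n)) → Prop} (hPR : ∀ X : Finset (Finset (Fin n)), P X → R X) :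
    ENNReal.ofReal (prob p d P) ≤ faceLaw n d p {S | R S} := by
  classical
  have hfin : ({s : Finset (Fin n) | s.card = d + 1}).Finite := Set.toFinite _
  have hprob : IsProbabilityMeasure (faceLaw n d p) := by unfold faceLaw; infer_instance
  have hset : {s : Finset (Fin n) | s.card = d + 1} =
      ((allFaces (Fin n) d).toFinset : Set (Finset (Fin n))) := by
    ext s; simp [mem_allFaces]
  have h1 : prob p d P = ∑ A ∈ (allFaces (Fin n) d).toFinset.powerset.filter P,
      (faceLaw n d p).real {(A : Set (Finset (Fin n)))} := by
    unfold prob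
    rw [avg_eq_sum_powerset (nodup_allFaces d), Finset.sum_filter]
    refine Finset.sum_congr rfl fun A hA => ?_
    have hA : A ⊆ (allFaces (Fin n) d).toFinset := Finset.mem_powerset.1 hA
    have hsub : (A : Set (Finset (Fin n))) ⊆ {s | s.card = d + 1} := by
      rw [hset]; exact_mod_cast hA
    rw [faceLaw, setBernoulli_real_singleton p hsub hfin, hset, ← Finset.coe_sdiff,
      Set.ncard_coe_finset, Set.ncard_coe_finset, Finset.empty_sdiff, Finset.union_empty]
    by_cases hP : P A <;> simp [ind, hP]
  have h2 : prob p d P = (faceLaw n d p).real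
      (⋃ A ∈ (allFaces (Fin n) d).toFinset.powerset.filter P, {(A : Set (Finset (Fin n)))}) := by
    rw [h1, measureReal_biUnion_finset]
    · intro A _ B _ hAB
      simpa using hAB
    · intro A _
      exact MeasurableSet.singleton _
  rw [h2, measureReal_def, ENNReal.ofReal_toReal (measure_ne_top _ _)]
  refine measure_mono ?_
  intro S hS
  simp only [Set.mem_iUnion, Set.mem_singleton_iff, exists_prop] at hS
  obtain ⟨A, hA, rfl⟩ := hS
  exact hPR A (Finset.mem_filter.1 hA).2

lemma tendsto_choose_atTop (hd : 1 ≤ d) : Tendsto (fun n : ℕ => (n.choose d : ℝ)) atTop atTop := by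
  have h1 : Tendsto (fun n : ℕ => ((n : ℝ) - d) / d.factorial) atTop atTop :=
    (tendsto_atTop_add_const_right _ _ tendsto_natCast_atTop_atTop).atTop_div_const
      (by exact_mod_cast Nat.factorial_pos d)
  refine tendsto_atTop_mono' _ ?_ h1
  filter_upwards [eventually_ge_atTop d] with n hn
  have h2 := Nat.pow_le_choose (α := ℝ) d n
  have h3 : ((n : ℝ) - d) ≤ ((n + 1 - d : ℕ) : ℝ) ^ d := by
    have h4 : (1 : ℝ) ≤ ((n + 1 - d : ℕ) : ℝ) := by exact_mod_cast (by omega : 1 ≤ n + 1 - d)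
    refine le_trans ?_ (le_self_pow₀ h4 (by omega))
    rw [Nat.cast_sub (by omega)]
    push_cast
    linarith
  exact (div_le_div_of_nonneg_right h3 (Nat.cast_nonneg _)).trans h2

/-- Above the critical value the top homology is nonzero asymptotically almost surely. -/
lemma IsCriticalRoot.tendsto_probHomologyNeZero (F : Type*) [Field F] (hd : 2 ≤ d) {b c : ℝ}
    (h : IsCriticalRoot d b) (hc : criticalValue d b < c) (p : ℕ → unitInterval)
    (hp : ∀ᶠ n : ℕ in atTop, (p n : ℝ) = c / n) :
    Tendsto (fun n : ℕ => probHomologyNeZero F n d (p n)) atTop (𝓝 1) := by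
  obtain ⟨κ, hκ, hev⟩ := h.exists_eventually_le_avg_nullity F hd hc
  have hc0 : 0 < c := (criticalValue_pos h.1.1 h.1.2).trans hc
  -- The failure probability is at most variance over squared mean, c C(n,d) / (κ C(n,d))².
  have hlow : Tendsto (fun n : ℕ => ENNReal.ofReal (1 - c / κ ^ 2 / n.choose d)) atTop (𝓝 1) := by
    have h1 : Tendsto (fun n : ℕ => 1 - c / κ ^ 2 / (n.choose d : ℝ)) atTop (𝓝 (1 - 0)) :=
      tendsto_const_nhds.sub ((tendsto_choose_atTop (by omega : 1 ≤ d)).const_div_atTop _)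
    have h2 := ENNReal.tendsto_ofReal h1
    simpa using h2
  refine tendsto_of_tendsto_of_tendsto_of_le_of_le' hlow tendsto_const_nhds ?_ ?_
  · filter_upwards [hp, hev, eventually_ge_atTop (d + 1),
      (tendsto_choose_atTop (by omega : 1 ≤ d)).eventually_gt_atTop 0] with n hpn hn hnd hC
    have hn0 : (0 : ℝ) < n := by exact_mod_cast (by omega : 0 < n)
    have h0 := (p n).2.1
    have h1 := (p n).2.2
    rw [hpn] at h0 h1
    have hm : 0 ≤ avg (c / n) (allFaces (Fin n) d) (nullity F d) ∅ := le_trans (by positivity) hn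
    have hcheb := prob_nullity_nonpos_mul_le (F := F) h0 h1 hm
    have hP0 := prob_nonneg (d := d) (P := fun X : Finset (Finset (Fin n)) => nullity F d X ≤ 0)
      h0 h1
    have hsq : (κ * n.choose d) ^ 2 ≤ avg (c / n) (allFaces (Fin n) d) (nullity F d) ∅ ^ 2 :=
      pow_le_pow_left₀ (by positivity) hn 2
    have h2 := (mul_le_mul_of_nonneg_left hsq hP0).trans hcheb
    have hchoose : (n.choose (d + 1) : ℝ) * (c / n) ≤ c * n.choose d := by
      have h3 : n.choose (d + 1) ≤ n.choose d * n := by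
        have := Nat.choose_succ_right_eq n d
        calc n.choose (d + 1) ≤ n.choose (d + 1) * (d + 1) := Nat.le_mul_of_pos_right _ (by omega)
          _ = n.choose d * (n - d) := this
          _ ≤ _ := Nat.mul_le_mul_left _ (Nat.sub_le _ _)
      have h3 : (n.choose (d + 1) : ℝ) ≤ n.choose d * n := by exact_mod_cast h3
      rw [mul_div_assoc', div_le_iff₀ hn0]
      nlinarith
    have h4 : prob (c / n) d (fun X : Finset (Finset (Fin n)) => nullity F d X ≤ 0) ≤
        c / κ ^ 2 / n.choose d := by
      rw [div_div, le_div_iff₀ (by positivity)]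
      have h5 := h2.trans hchoose
      rw [mul_pow, sq (n.choose d : ℝ), ← mul_assoc, ← mul_assoc] at h5
      have h6 := le_of_mul_le_mul_right h5 hC
      linarith
    have h5 : 1 - c / κ ^ 2 / n.choose d ≤
        prob (p n) d (fun X : Finset (Finset (Fin n)) => ¬ nullity F d X ≤ 0) := by
      rw [prob_not, hpn]
      linarith
    refine (ENNReal.ofReal_le_ofReal h5).trans (ofReal_prob_le (p n) fun X hX => ?_)
    exact nontrivial_homology_of_nullity_pos (by omega) (not_le.1 hX)
  · refine Eventually.of_forall fun n => ?_
    have : IsProbabilityMeasure (faceLaw n d (p n)) := by unfold faceLaw; infer_instance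
    exact MeasureTheory.prob_le_one

end Nullity

end RandomComplex

theorem theorem1 (F : Type*) [Field F] :
    ∃ β : ℕ → ℝ,
      -- `β d` is the unique root in `(0, 1)`
      (∀ d : ℕ, 2 ≤ d → RandomComplex.IsCriticalRoot d (β d) ∧
        ∀ b : ℝ, RandomComplex.IsCriticalRoot d b → b = β d) ∧
      -- above `c*_d` the top homology is nonzero asymptotically almost surely
      (∀ d : ℕ, 2 ≤ d → ∀ c : ℝ, RandomComplex.criticalValue d (β d) < c →
        ∀ p : ℕ → unitInterval, (∀ᶠ n : ℕ in atTop, (p n : ℝ) = c / n) →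
          Tendsto (fun n : ℕ => RandomComplex.probHomologyNeZero F n d (p n)) atTop (𝓝 1)) ∧
      -- numerical values, rounded to the digits shown
      |RandomComplex.criticalValue 2 (β 2) - 2.75381| ≤ 0.000005 ∧
      |RandomComplex.criticalValue 3 (β 3) - 3.90708| ≤ 0.000005 ∧
      |β 2 - 0.883414| ≤ 0.0000005 ∧
      |β 3 - 0.972498| ≤ 0.0000005 ∧
      -- `c*_d = (d + 1) - (d + 1) e^{-(d+1)} + O(d³ e^{-2d})`
      (fun d : ℕ => RandomComplex.criticalValue d (β d) -
          (((d : ℝ) + 1) - ((d : ℝ) + 1) / Real.exp ((d : ℝ) + 1)))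
        =O[atTop] (fun d : ℕ => (d : ℝ) ^ 3 / Real.exp (2 * (d : ℝ))) ∧
      -- `β_d = 1 - e^{-(d+1)} - (1 + o(1)) (d + 1)² e^{-2(d+1)}`
      (∃ δ : ℕ → ℝ, Tendsto δ atTop (𝓝 0) ∧ ∀ d : ℕ, 2 ≤ d →
        β d = 1 - Real.exp (-((d : ℝ) + 1)) -
          (1 + δ d) * (((d : ℝ) + 1) ^ 2 / Real.exp (2 * ((d : ℝ) + 1)))) := by
  have hex : ∀ d : ℕ, ∃ b : ℝ, 2 ≤ d → RandomComplex.IsCriticalRoot d b := by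
    intro d
    by_cases hd : 2 ≤ d
    · obtain ⟨b, hb⟩ := RandomComplex.exists_isCriticalRoot hd
      exact ⟨b, fun _ => hb⟩
    · exact ⟨0, fun h => absurd h hd⟩
  choose β hβ using hex
  -- Both explicit error bounds require (d+1)² e^(-(d+1)) ≤ 1/8, which holds for large `d`.
  have hsmall := RandomComplex.tendsto_sq_mul_exp_neg.eventually_le_const
    (show (0 : ℝ) < 1 / 8 by norm_num)
  refine ⟨β, fun d hd => ⟨hβ d hd, fun b hb => hb.unique hd (hβ d hd)⟩,
    fun d hd c hc p hp => (hβ d hd).tendsto_probHomologyNeZero F hd hc p hp,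
    (hβ 2 le_rfl).criticalValue_two, (hβ 3 (by norm_num)).criticalValue_three, ?_, ?_, ?_, ?_⟩
  · have h := (hβ 2 le_rfl).two_mem
    rw [abs_le]
    constructor <;> linarith [h.1, h.2]
  · have h := (hβ 3 (by norm_num)).three_mem
    rw [abs_le]
    constructor <;> linarith [h.1, h.2]
  · refine IsBigO.of_bound 96 ?_
    filter_upwards [hsmall, eventually_ge_atTop 2] with d hw hd
    rw [Real.norm_eq_abs, Real.norm_of_nonneg (by positivity)]
    exact (hβ d hd).abs_criticalValue_sub_le hd hw
  · have hpos : ∀ d : ℕ, 0 < ((d : ℝ) + 1) ^ 2 / Real.exp (2 * ((d : ℝ) + 1)) :=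
      fun d => by positivity
    -- `δ` is obtained by solving the expansion for it, so the identity holds for every `d` and only
    -- the limit needs the error bound.
    refine ⟨fun d => (1 - β d - Real.exp (-((d : ℝ) + 1))) /
      (((d : ℝ) + 1) ^ 2 / Real.exp (2 * ((d : ℝ) + 1))) - 1, ?_, fun d _ => ?_⟩
    · have hlim : Tendsto (fun d : ℕ => 8 * (((d : ℝ) + 1) ^ 2 * Real.exp (-((d : ℝ) + 1)))) atTop
          (𝓝 0) := by
        simpa using RandomComplex.tendsto_sq_mul_exp_neg.const_mul 8
      refine squeeze_zero_norm' ?_ hlim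
      filter_upwards [hsmall, eventually_ge_atTop 2] with d hw hd
      have h := (hβ d hd).abs_one_sub_sub_le hd hw
      have e : ((d : ℝ) + 1) ^ 2 / Real.exp (2 * ((d : ℝ) + 1)) =
          ((d : ℝ) + 1) ^ 2 * Real.exp (-((d : ℝ) + 1)) ^ 2 := by
        rw [div_eq_mul_inv, ← Real.exp_neg, sq (Real.exp _), ← Real.exp_add]
        congr 2
        ring
      have hp := hpos d
      rw [e] at hp ⊢
      rw [Real.norm_eq_abs, div_sub_one hp.ne', abs_div, abs_of_pos hp, div_le_iff₀ hp]
      exact h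
    · have := hpos d
      field_simp
      ring
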